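/- Let $k$ be an infinite field, let $S=k[x_0,\dots,x_n]$ be a polynomial ring with homogeneous maximal ideal $\mathfrak m=(x_0,\dots,x_n)$, and let $I\subset S$ be an ideal of codimension (height) at least $2$ that is generated by a $k$-vector space $W$ of forms of the same degree. Let $\ell(I)=\dim S[It]/\mathfrak m S[It]$ be the analytic spread of $I$; equivalently, $\ell(I)$ is one plus the dimension of the image of the rational map $\mathbf P^n \dashrightarrow \mathbf P(W)$ defined by $W$. A homogeneous presentation matrix of an ideal $J$ generated by forms is a matrix $A$ of a homogeneous free presentation $F\to G\to J\to 0$ in which the basis of $G$ maps to a minimal set of homogeneous generators of $J$ (rows correspond to generators of $J$, columns to homogeneous syzygies generating the syzygy module). The row ideals of $A$ are the ideals generated by the entries of the individual rows of $A$. When the generators have the same degree, the generalized row ideals of $A$ are the ideals generated by the entries of the individual nonzero $k$-linear combinations of the rows of $A$ (that is, combinations with coefficients in $k$, not all zero). An ideal is called linear if it is generated by linear forms (the zero ideal is allowed). Suppose that $I$ has a homogeneous presentation matrix all of whose entries are linear forms or zero, or merely that all generalized row ideals of a homogeneous presentation matrix of $I$ are linear. Then for every $d\ge 1$ the ideal $I^d$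 has a homogeneous presentation matrix all of whose row ideals are linear of codimension $\ell(I)-1$. -/

import Mathlib

namespace RowIdeals

open MvPolynomial

variable {k : Type*} [Field k] {n : ℕ}

/-- An ideal of `k[x₀,…,xₙ]` is linear if it is generated by linear forms
(the zero ideal, generated by the empty set, is linear). -/
def IsLinearIdeal (J : Ideal (MvPolynomial (Fin (n + 1)) k)) : Prop :=
  ∃ T : Set (MvPolynomial (Fin (n + 1)) k),
    (∀ f ∈ T, f.IsHomogeneous 1) ∧ J = Ideal.span T

/-- `A` is a homogeneous presentation matrix of the ideal `I` with respect to the homogeneous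
minimal generating set `g₀,…`: rows correspond to generators, columns to generating syzygies.
That is, `F → G → I → 0` is exact, where `G` is free on the `g i`, the map `F → G` is given by
`A`, and all maps are homogeneous of degree `0` for a suitable grading of the free module `F`. -/
structure IsHomogeneousPresentation (I : Ideal (MvPolynomial (Fin (n + 1)) k)) {m c : ℕ}
    (g : Fin m → MvPolynomial (Fin (n + 1)) k)
    (A : Matrix (Fin m) (Fin c) (MvPolynomial (Fin (n + 1)) k)) : Prop where
  /-- The `g i` generate `I`. -/
  span_eq : Ideal.span (Set.range g) = I
  /-- No generator can be omitted. -/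
  minimal : ∀ i, g i ∉ Ideal.span (g '' {j | j ≠ i})
  /-- The generators are forms, and the `j`-th column is homogeneous of some degree `b j`:
  its `i`-th entry is zero or a form of degree `b j - a i`, where `a i` is the degree of `g i`. -/
  homogeneous : ∃ (a : Fin m → ℕ) (b : Fin c → ℕ), (∀ i, (g i).IsHomogeneous (a i)) ∧
    ∀ i j, A i j ≠ 0 → ∃ e : ℕ, a i + e = b j ∧ (A i j).IsHomogeneous e
  /-- The columns of `A` generate the module of syzygies of `g`. -/
  exact : ∀ v : Fin m → MvPolynomial (Fin (n + 1)) k,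
    ∑ i, v i * g i = 0 ↔
      v ∈ Submodule.span (MvPolynomial (Fin (n + 1)) k) (Set.range fun j i => A i j)

/-- The row ideal of the `i`-th row: the ideal generated by the entries of the row. -/
noncomputable def rowIdeal {m c : ℕ} (A : Matrix (Fin m) (Fin c) (MvPolynomial (Fin (n + 1)) k)) (i : Fin m) :
    Ideal (MvPolynomial (Fin (n + 1)) k) :=
  Ideal.span (Set.range (A i))

/-- The ideal generated by the entries of the `k`-linear combination of the rows of `A` with
coefficients `q`. If `A` is a presentation matrix with respect to a basis `g` of `W`, a nonzero
`q` is a nonzero functional `g i ↦ q i` on `W`, i.e. (up to scalars) a codimension one subspace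
`W_q` of `W`, namely its kernel; the combination is then the matrix of the composite
`F → S ⊗ W → S ⊗ (W / W_q) ≅ S`, the generalized row corresponding to the point `q`. -/
noncomputable def generalizedRowIdeal {m c : ℕ}
    (A : Matrix (Fin m) (Fin c) (MvPolynomial (Fin (n + 1)) k)) (q : Fin m → k) :
    Ideal (MvPolynomial (Fin (n + 1)) k) :=
  Ideal.span (Set.range fun j => ∑ i, C (q i) * A i j)

/-- `I` has a homogeneous presentation matrix all of whose entries are linear forms (or zero). -/
def IsLinearlyPresented (I : Ideal (MvPolynomial (Fin (n + 1)) k)) : Prop :=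
  ∃ (m c : ℕ) (g : Fin m → MvPolynomial (Fin (n + 1)) k)
    (A : Matrix (Fin m) (Fin c) (MvPolynomial (Fin (n + 1)) k)),
    IsHomogeneousPresentation I g A ∧ ∀ i j, (A i j).IsHomogeneous 1

/-- All generalized row ideals of a homogeneous presentation matrix of `I` (an ideal generated by
forms of one degree) are linear. -/
def HasLinearGeneralizedRowIdeals (I : Ideal (MvPolynomial (Fin (n + 1)) k)) : Prop :=
  ∃ (m c : ℕ) (g : Fin m → MvPolynomial (Fin (n + 1)) k)
    (A : Matrix (Fin m) (Fin c) (MvPolynomial (Fin (n + 1)) k)),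
    IsHomogeneousPresentation I g A ∧
      ∀ q : Fin m → k, q ≠ 0 → IsLinearIdeal (generalizedRowIdeal A q)

/-- The analytic spread `ℓ(I)`: the Krull dimension of the special fiber ring `R / 𝔪R`, where
`R = S[It]` is the Rees algebra of `I` and `𝔪 = (x₀,…,xₙ)`. When `I` is generated by a space `W`
of forms of the same degree, `R / 𝔪R` is the homogeneous coordinate ring of the closed image of
the rational map `ℙⁿ ⇢ ℙ(W)`, so that `ℓ(I)` is one plus the dimension of that image. -/
noncomputable def analyticSpread (I : Ideal (MvPolynomial (Fin (n + 1)) k)) : WithBot ℕ∞ :=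
  ringKrullDim (reesAlgebra I ⧸
    (Ideal.span (Set.range (X : Fin (n + 1) → MvPolynomial (Fin (n + 1)) k))).map
      (algebraMap (MvPolynomial (Fin (n + 1)) k) (reesAlgebra I)))

end RowIdeals

/-!
Let `p` be a point at which `W` does not vanish, let `w ∈ W` with `w(p) = 1`, and let `W_p ⊆ W` be
the forms vanishing at `p`. The generalized row ideal `J_p` given by evaluation at `p` is the colon
ideal `(W_p) : w`. It is linear, hence prime, and its zero locus is the fibre through `p` of the
rational map defined by `W`. The fibres are thus linear spaces, so that, when `p` is general, the
height of `J_p` is the dimension `ℓ(I) - 1` of the image: slicing with a complementary linear space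
gives a rational section, which bounds the dimension of the image from above, while the linear
equations of the fibres bound it from below.

Now choose a basis `b_i` of `W ^ d` dual to evaluation at general points `p_i`. Since the colon
ideal above is prime and `W ^ d` is spanned by `w ^ d` modulo `(W_p)`, the row ideals of a
presentation of `I ^ d` on this basis are `((W ^ d)_{p_i}) : b_i = J_{p_i}`.
-/

namespace RowIdeals

open MvPolynomial Module

theorem ringKrullDim_eq_of_isIntegral (A B : Type*) [CommRing A] [CommRing B] [Algebra A B]
    [Algebra.IsIntegral A B] [FaithfulSMul A B] : ringKrullDim A = ringKrullDim B := by
  refine le_antisymm (iSup_le fun chain => ?_) ?_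
  · obtain ⟨⟨P, _, _⟩⟩ := Ideal.nonempty_primesOver (S := B) chain.head.asIdeal
    obtain ⟨lift, hlift, -⟩ := Ideal.exists_ltSeries_of_hasGoingUp chain P
    exact hlift ▸ Order.LTSeries.length_le_krullDim lift
  · exact Order.krullDim_le_of_strictMono (PrimeSpectrum.comap (algebraMap A B)) fun P Q h =>
      Ideal.IsIntegral.comap_lt_comap (R := A) (I := P.asIdeal) (J := Q.asIdeal) h

theorem ringKrullDim_eq_trdeg (k B : Type*) [Field k] [CommRing B] [IsDomain B] [Algebra k B]
    [Algebra.FiniteType k B] : ringKrullDim B = (Algebra.trdeg k B).toENat := by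
  obtain ⟨s, normalization, hinj, hintegral⟩ := exists_integral_inj_algHom_of_fg k B
  let _ := normalization.toRingHom.toAlgebra
  have : IsScalarTower k (MvPolynomial (Fin s) k) B :=
    .of_algebraMap_eq' normalization.comp_algebraMap.symm
  have : Algebra.IsIntegral (MvPolynomial (Fin s) k) B := ⟨hintegral⟩
  have : FaithfulSMul (MvPolynomial (Fin s) k) B :=
    (faithfulSMul_iff_algebraMap_injective _ _).2 hinj
  have htrdeg : Algebra.trdeg k B = s := by
    have h := lift_trdeg_add_eq k (MvPolynomial (Fin s) k) B
    rw [trdeg_eq_zero (R := MvPolynomial (Fin s) k) (A := B)] at h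
    simpa using h.symm
  rw [← ringKrullDim_eq_of_isIntegral (MvPolynomial (Fin s) k) B,
    MvPolynomial.ringKrullDim_of_isNoetherianRing, htrdeg]
  simp

section LinearForms

variable {k : Type*} [CommRing k] {σ : Type*}

/-- The coefficient vector of the linear part of a polynomial. -/
noncomputable def linearCoeff : MvPolynomial σ k →ₗ[k] σ → k :=
  LinearMap.pi fun l => lcoeff k (Finsupp.single l 1)

@[simp]
theorem linearCoeff_apply (f : MvPolynomial σ k) (l : σ) :
    linearCoeff f l = coeff (Finsupp.single l 1) f := rfl

theorem linearCoeff_mul (a f : MvPolynomial σ k) :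
    linearCoeff (a * f) = constantCoeff a • linearCoeff f + constantCoeff f • linearCoeff a := by
  classical
  ext l
  simp [coeff_mul, Finsupp.antidiagonal_single, Finset.Nat.antidiagonal_succ, constantCoeff_eq]
  ring

theorem map_linearCoeff_span {F : Set (MvPolynomial σ k)} (hF : ∀ f ∈ F, constantCoeff f = 0) :
    ((Ideal.span F).restrictScalars k).map linearCoeff = Submodule.span k (linearCoeff '' F) := by
  refine le_antisymm ?_ (Submodule.span_le.2 (Set.image_mono Ideal.subset_span))
  rintro _ ⟨f, hf, rfl⟩
  suffices constantCoeff f = 0 ∧ linearCoeff f ∈ Submodule.span k (linearCoeff '' F) from this.2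
  induction hf using Submodule.span_induction with
  | mem f hf => exact ⟨hF f hf, Submodule.subset_span ⟨f, hf, rfl⟩⟩
  | zero => simp
  | add f g _ _ hf hg =>
    rw [map_add, map_add, hf.1, hg.1]
    exact ⟨add_zero 0, add_mem hf.2 hg.2⟩
  | smul a f _ hf =>
    rw [smul_eq_mul, map_mul, linearCoeff_mul, hf.1, zero_smul, add_zero]
    exact ⟨mul_zero _, Submodule.smul_mem _ _ hf.2⟩

variable [Fintype σ]

/-- The linear form with a given coefficient vector. -/
noncomputable def linearForm : (σ → k) →ₗ[k] MvPolynomial σ k :=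
  Fintype.linearCombination k X

theorem linearForm_apply (v : σ → k) : linearForm v = ∑ l, C (v l) * X l := by
  simp [linearForm, Fintype.linearCombination_apply, smul_eq_C_mul]

theorem isHomogeneous_linearForm (v : σ → k) : (linearForm v).IsHomogeneous 1 := by
  rw [linearForm_apply]
  exact .sum _ _ _ fun l _ => isHomogeneous_C_mul_X _ _

@[simp]
theorem linearForm_single [DecidableEq σ] (l : σ) :
    linearForm (Pi.single l 1 : σ → k) = X l := by
  simp [linearForm]

@[simp]
theorem linearCoeff_linearForm (v : σ → k) : linearCoeff (linearForm v) = v := by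
  classical
  ext l
  simp [linearForm_apply, coeff_sum, coeff_C_mul, coeff_X, Finsupp.single_left_inj]

theorem linearForm_linearCoeff (f : MvPolynomial σ k) :
    linearForm (linearCoeff f) = homogeneousComponent 1 f := by
  classical
  ext e
  rw [coeff_homogeneousComponent]
  split_ifs with he
  · obtain ⟨l, rfl⟩ := (Finsupp.sum_eq_one_iff e).1 he
    exact congrFun (linearCoeff_linearForm (linearCoeff f)) l
  · exact (isHomogeneous_linearForm _).coeff_eq_zero he

/-- The ideal generated by a module of linear forms, given by their coefficient vectors. -/
noncomputable def linearIdeal (V : Submodule k (σ → k)) : Ideal (MvPolynomial σ k) :=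
  Ideal.span (linearForm '' V)

theorem linearIdeal_span (s : Set (σ → k)) :
    linearIdeal (Submodule.span k s) = Ideal.span (linearForm '' s) := by
  refine le_antisymm (Ideal.span_le.2 ?_)
    (Ideal.span_mono (Set.image_mono Submodule.subset_span))
  have h : Submodule.span k s ≤
      ((Ideal.span (linearForm '' s)).restrictScalars k).comap linearForm :=
    Submodule.span_le.2 fun v hv => Ideal.subset_span (Set.mem_image_of_mem _ hv)
  rintro _ ⟨v, hv, rfl⟩
  exact h hv

theorem span_eq_linearIdeal {T : Set (MvPolynomial σ k)} (hT : ∀ f ∈ T, f.IsHomogeneous 1) :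
    Ideal.span T = linearIdeal (((Ideal.span T).restrictScalars k).map linearCoeff) := by
  have hT_image : (linearForm ∘ linearCoeff) '' T = T :=
    Set.EqOn.image_eq_self fun f hf =>
      (linearForm_linearCoeff f).trans (homogeneousComponent_eq_self (hT f hf))
  rw [map_linearCoeff_span fun f hf => (hT f hf).coeff_eq_zero (by simp), linearIdeal_span,
    ← Set.image_comp, hT_image]

theorem map_linearCoeff_linearIdeal (V : Submodule k (σ → k)) :
    ((linearIdeal V).restrictScalars k).map linearCoeff = V := by
  rw [linearIdeal, map_linearCoeff_span, ← Set.image_comp]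
  · simp
  · rintro _ ⟨v, -, rfl⟩
    exact (isHomogeneous_linearForm v).coeff_eq_zero (by simp)

theorem linearIdeal_strictMono :
    StrictMono (linearIdeal : Submodule k (σ → k) → Ideal (MvPolynomial σ k)) :=
  Monotone.strictMono_of_injective
    (fun _ _ h => Ideal.span_mono (Set.image_mono h))
    (Function.HasLeftInverse.injective
      ⟨fun J => (J.restrictScalars k).map linearCoeff, map_linearCoeff_linearIdeal⟩)

theorem linearIdeal_eq_ker [DecidableEq σ] {V : Submodule k (σ → k)}
    {π : (σ → k) →ₗ[k] σ → k} (hker : LinearMap.ker π = V) (hsub : ∀ v, v - π v ∈ V) :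
    linearIdeal V = RingHom.ker (aeval fun l => linearForm (π (Pi.single l 1))) := by
  set φ : MvPolynomial σ k →ₐ[k] MvPolynomial σ k :=
    aeval fun l => linearForm (π (Pi.single l 1)) with hφ
  have hφ_linearForm : ∀ v, φ (linearForm v) = linearForm (π v) := by
    intro v
    conv_rhs => rw [pi_eq_sum_univ' v]
    simp [hφ, linearForm_apply v, ← smul_eq_C_mul]
  have hφ_congr : (Ideal.Quotient.mkₐ k (linearIdeal V)).comp φ = Ideal.Quotient.mkₐ k _ := by
    ext l
    rw [AlgHom.comp_apply, hφ, aeval_X, ← linearForm_single l, Ideal.Quotient.mkₐ_eq_mk,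
      eq_comm, Ideal.Quotient.eq, ← map_sub]
    exact Ideal.subset_span ⟨_, hsub _, rfl⟩
  refine le_antisymm (Ideal.span_le.2 ?_) fun f hf => ?_
  · rintro _ ⟨v, hv, rfl⟩
    rw [← hker] at hv
    exact (hφ_linearForm v).trans (by rw [hv, map_zero])
  · have h := DFunLike.congr_fun hφ_congr f
    rw [AlgHom.comp_apply, show φ f = 0 from hf, map_zero] at h
    exact Ideal.Quotient.eq_zero_iff_mem.1 h.symm

end LinearForms

section LinearPrimes

variable {k σ : Type*} [Field k] [Fintype σ]

instance isPrime_linearIdeal (V : Submodule k (σ → k)) : (linearIdeal V).IsPrime := by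
  classical
  obtain ⟨V', h⟩ := V.exists_isCompl
  rw [linearIdeal_eq_ker (Submodule.ker_projection h.symm) fun v => by
    rw [← Submodule.projection_eq_self_sub_projection h.symm]
    exact Submodule.projection_apply_mem _ _]
  exact RingHom.ker_isPrime _

theorem height_linearIdeal (V : Submodule k (σ → k)) :
    (linearIdeal V).height = finrank k V := by
  apply le_antisymm
  · have hV : V.FG := IsNoetherian.noetherian V
    have hcard : V.generators.ncard = finrank k V := by
      rw [hV.generators_ncard, finrank_eq_spanFinrank_of_free, Submodule.spanFinrank_top]
    have hspan : (linearIdeal V).spanFinrank ≤ finrank k V := by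
      rw [← V.span_generators, linearIdeal_span, V.span_generators, ← hcard]
      exact (Submodule.spanFinrank_span_le_ncard_of_finite (hV.finite_generators.image _)).trans
        (Set.ncard_image_le hV.finite_generators)
    exact (Ideal.height_le_spanFinrank _ (isPrime_linearIdeal V).ne_top).trans
      (by exact_mod_cast hspan)
  · let primeOf (U : Submodule k (σ → k)) : PrimeSpectrum (MvPolynomial σ k) :=
      ⟨linearIdeal U, inferInstance⟩
    have hmono : StrictMono primeOf := fun _ _ h => linearIdeal_strictMono h
    rw [← length_eq_finrank, length_submodule]
    exact (Order.height_le_height_apply_of_strictMono primeOf hmono V).trans_eq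
      (PrimeSpectrum.height_eq_orderHeight (primeOf V)).symm

end LinearPrimes

section RankMinors

open Matrix

variable {κ σ R : Type*} [CommRing R] {A : Matrix κ σ R} {r : ℕ} {ρ : Fin r → κ} {γ : Fin r → σ}

/-- The minor of `A` with rows `ρ` and columns `γ` is nonzero of maximal size. Over a field the
factorization says that `A` has rank at most `r`; its denominators are cleared here so that it
specializes along ring homomorphisms. -/
structure IsRankMinor (A : Matrix κ σ R) (ρ : Fin r → κ) (γ : Fin r → σ) : Prop where
  det_ne_zero : (A.submatrix ρ γ).det ≠ 0
  det_smul_eq : (A.submatrix ρ γ).det • A =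
    A.submatrix id γ * (A.submatrix ρ γ).adjugate * A.submatrix ρ id

theorem IsRankMinor.of_map {K : Type*} [CommRing K] {φ : R →+* K} (hφ : Function.Injective φ)
    (h : IsRankMinor (A.map φ) ρ γ) : IsRankMinor A ρ γ := by
  have hdet : ((A.map φ).submatrix ρ γ).det = φ (A.submatrix ρ γ).det := (φ.map_det _).symm
  have hadj : ((A.map φ).submatrix ρ γ).adjugate = (A.submatrix ρ γ).adjugate.map φ :=
    (φ.map_adjugate _).symm
  have hmul : (A.map φ).submatrix id γ * ((A.map φ).submatrix ρ γ).adjugate *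
      (A.map φ).submatrix ρ id =
      (A.submatrix id γ * (A.submatrix ρ γ).adjugate * A.submatrix ρ id).map φ := by
    rw [hadj, Matrix.map_mul, Matrix.map_mul]
    rfl
  have hsmul : φ (A.submatrix ρ γ).det • A.map φ = ((A.submatrix ρ γ).det • A).map φ :=
    Matrix.ext fun i l => (map_mul φ _ (A i l)).symm
  refine ⟨fun hzero => h.det_ne_zero (by rw [hdet, hzero, map_zero]), Matrix.map_injective hφ ?_⟩
  exact hsmul.symm.trans ((hdet ▸ h.det_smul_eq).trans hmul)

theorem exists_linearIndependent_row_eq_mul {K : Type*} [Field K] [Fintype σ] [Finite κ]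
    {A : Matrix κ σ K} (hr : A.rank = r) :
    ∃ ρ : Fin r → κ, LinearIndependent K (A.submatrix ρ id).row ∧
      ∃ Y : Matrix κ (Fin r) K, A = Y * A.submatrix ρ id := by
  rw [rank_eq_finrank_span_row] at hr
  subst hr
  obtain ⟨row, hrow, hspan, hli⟩ := Submodule.exists_fun_fin_finrank_span_eq K (Set.range A.row)
  choose ρ hρ using hrow
  have hsub : (A.submatrix ρ id).row = row := funext hρ
  rw [← hsub] at hspan hli
  refine ⟨ρ, hli, ?_⟩
  have hmem (i : κ) : A i ∈ Submodule.span K (Set.range (A.submatrix ρ id).row) := by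
    rw [hspan]
    exact Submodule.subset_span ⟨i, rfl⟩
  choose Y hY using fun i => (Submodule.mem_span_range_iff_exists_fun K).1 (hmem i)
  refine ⟨.of Y, Matrix.ext fun i l => ?_⟩
  simpa [Matrix.mul_apply, Finset.sum_apply] using (congrFun (hY i) l).symm

theorem exists_isRankMinor_of_field {K : Type*} [Field K] [Finite σ] [Finite κ]
    (A : Matrix κ σ K) : ∃ (r : ℕ) (ρ : Fin r → κ) (γ : Fin r → σ), IsRankMinor A ρ γ := by
  have := Fintype.ofFinite σ
  obtain ⟨ρ, hρ, Y, hY⟩ := exists_linearIndependent_row_eq_mul (A := A) rfl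
  have hrank : (A.submatrix ρ id)ᵀ.rank = A.rank := by
    rw [rank_transpose, hρ.rank_matrix, Fintype.card_fin]
  obtain ⟨γ, hγ, -⟩ := exists_linearIndependent_row_eq_mul hrank
  have hunit : IsUnit (A.submatrix ρ γ) := linearIndependent_cols_iff_isUnit.1 hγ
  have hdet : IsUnit (A.submatrix ρ γ).det := (isUnit_iff_isUnit_det _).1 hunit
  have hcols : A.submatrix id γ = Y * A.submatrix ρ γ := congrArg (·.submatrix id γ) hY
  refine ⟨_, ρ, γ, hdet.ne_zero, ?_⟩
  rw [hcols, Matrix.mul_assoc Y, mul_adjugate, Matrix.mul_smul, Matrix.mul_one, Matrix.smul_mul,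
    ← hY]

theorem exists_isRankMinor [IsDomain R] [Finite σ] [Finite κ] (A : Matrix κ σ R) :
    ∃ (r : ℕ) (ρ : Fin r → κ) (γ : Fin r → σ), IsRankMinor A ρ γ := by
  obtain ⟨r, ρ, γ, h⟩ := exists_isRankMinor_of_field (A.map (algebraMap R (FractionRing R)))
  exact ⟨r, ρ, γ, h.of_map (IsFractionRing.injective R _)⟩

namespace IsRankMinor

theorem injective (h : IsRankMinor A ρ γ) : Function.Injective γ := fun i j hij => by
  by_contra hne
  exact h.det_ne_zero (det_zero_of_column_eq hne fun l => by simp [hij])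

theorem rank_map [Fintype σ] (h : IsRankMinor A ρ γ) {K : Type*} [Field K] (φ : R →+* K)
    (hφ : φ (A.submatrix ρ γ).det ≠ 0) : (A.map φ).rank = r := by
  classical
  refine le_antisymm ?_ ?_
  · have hfactor : A.map φ = (φ (A.submatrix ρ γ).det)⁻¹ •
        (A.submatrix id γ * (A.submatrix ρ γ).adjugate).map φ * (A.submatrix ρ id).map φ := by
      rw [Matrix.smul_mul, ← Matrix.map_mul, ← h.det_smul_eq, eq_inv_smul_iff₀ hφ]
      exact Matrix.ext fun i l => (map_mul φ _ (A i l)).symm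
    rw [hfactor]
    exact (rank_mul_le_left _ _).trans ((rank_le_card_width _).trans_eq (Fintype.card_fin r))
  · have hunit : IsUnit ((A.submatrix ρ γ).map φ) := by
      rw [isUnit_iff_isUnit_det, ← RingHom.mapMatrix_apply, ← RingHom.map_det]
      exact hφ.isUnit
    calc r = ((A.map φ).submatrix ρ γ).rank :=
          ((rank_of_isUnit _ hunit).trans (Fintype.card_fin r)).symm
      _ ≤ (A.map φ).rank := rank_submatrix_le _ _ _

end IsRankMinor

variable [DecidableEq σ]

/-- A matrix whose image lies in the kernel of `A` when the minor of `A` with rows `ρ` and columns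
`γ` is of maximal size: by Cramer's rule it multiplies the coordinates outside `γ` by this minor
and solves `A *ᵥ y = 0` for the remaining ones. -/
def kernelMatrix (A : Matrix κ σ R) (ρ : Fin r → κ) (γ : Fin r → σ) : Matrix σ σ R :=
  (A.submatrix ρ γ).det • 1 -
    (1 : Matrix σ σ R).submatrix id γ * (A.submatrix ρ γ).adjugate * A.submatrix ρ id

theorem map_kernelMatrix {K : Type*} [CommRing K] (φ : R →+* K) :
    (kernelMatrix A ρ γ).map φ = kernelMatrix (A.map φ) ρ γ := by
  have hone : ((1 : Matrix σ σ R).submatrix id γ).map φ = (1 : Matrix σ σ K).submatrix id γ :=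
    congrArg (·.submatrix id γ) (Matrix.map_one φ (map_zero φ) (map_one φ))
  have hadj : (A.submatrix ρ γ).adjugate.map φ = ((A.map φ).submatrix ρ γ).adjugate :=
    φ.map_adjugate _
  have hdet : φ (A.submatrix ρ γ).det = ((A.map φ).submatrix ρ γ).det := φ.map_det _
  rw [kernelMatrix, Matrix.map_sub φ (map_sub φ), Matrix.map_smul' φ _ _ (map_mul φ),
    Matrix.map_mul, Matrix.map_mul, hone, hadj, hdet, Matrix.map_one φ (map_zero φ) (map_one φ)]
  rfl

variable [Fintype σ]

theorem mul_kernelMatrix (h : IsRankMinor A ρ γ) : A * kernelMatrix A ρ γ = 0 := by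
  have hcols : A * (1 : Matrix σ σ R).submatrix id γ = A.submatrix id γ := by
    ext i j
    simp [Matrix.mul_apply, Matrix.one_apply]
  rw [kernelMatrix, Matrix.mul_sub, Matrix.mul_smul, Matrix.mul_one, ← Matrix.mul_assoc,
    ← Matrix.mul_assoc, hcols, h.det_smul_eq, sub_self]

theorem kernelMatrix_mulVec_of_mulVec_eq_zero {y : σ → R} (hy : A *ᵥ y = 0) :
    kernelMatrix A ρ γ *ᵥ y = (A.submatrix ρ γ).det • y := by
  have hrows : A.submatrix ρ id *ᵥ y = 0 := funext fun i => congrFun hy (ρ i)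
  rw [kernelMatrix, sub_mulVec, smul_mulVec, one_mulVec, ← mulVec_mulVec, hrows, mulVec_zero,
    sub_zero]

theorem kernelMatrix_mulVec_apply {l : σ} (hl : l ∉ Set.range γ) (y : σ → R) :
    (kernelMatrix A ρ γ *ᵥ y) l = (A.submatrix ρ γ).det * y l := by
  have hrow : (1 : Matrix σ σ R).submatrix id γ l = 0 :=
    funext fun i => one_apply_ne fun h => hl ⟨i, h.symm⟩
  have hzero : ((1 : Matrix σ σ R).submatrix id γ *ᵥ
      ((A.submatrix ρ γ).adjugate * A.submatrix ρ id) *ᵥ y) l = 0 := by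
    rw [mulVec, hrow, zero_dotProduct]
  rw [kernelMatrix, sub_mulVec, smul_mulVec, one_mulVec, Matrix.mul_assoc, ← mulVec_mulVec,
    Pi.sub_apply, hzero, sub_zero, Pi.smul_apply, smul_eq_mul]

end RankMinors

section CoordinateRing

open Matrix Cardinal

variable {k S : Type*} [CommRing S]

/-- The subalgebra `k[Vt]` of `S[t]`. For a space `V` of forms of the same degree it is the
homogeneous coordinate ring of the image of the rational map defined by `V`. -/
noncomputable def coordinateRing [CommRing k] [Algebra k S] (V : Submodule k S) :
    Subalgebra k (Polynomial S) :=
  Algebra.adjoin k (Polynomial.monomial 1 '' V)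

theorem monomial_mem_coordinateRing [CommRing k] [Algebra k S] {V : Submodule k S} {w : S}
    (hw : w ∈ V) : Polynomial.monomial 1 w ∈ coordinateRing V :=
  Algebra.subset_adjoin (Set.mem_image_of_mem _ hw)

theorem trdeg_le_of_le_adjoin {L : Type*} [CommRing k] [IsDomain k] [CommRing L] [Algebra k L]
    {D : Subalgebra k L} {τ : Type*} [Fintype τ] {z : τ → L}
    (hD : D ≤ Algebra.adjoin k (Set.range z)) : Algebra.trdeg k D ≤ Fintype.card τ := by
  rw [Algebra.adjoin_range_eq_range_aeval] at hD
  have hrange : Algebra.trdeg k (aeval z : MvPolynomial τ k →ₐ[k] L).range ≤ Fintype.card τ := by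
    have h := lift_trdeg_le_of_surjective (aeval z : MvPolynomial τ k →ₐ[k] L).rangeRestrict
      (aeval z).rangeRestrict_surjective
    rw [MvPolynomial.trdeg_of_isDomain] at h
    simpa using h
  exact (trdeg_le_of_injective (Subalgebra.inclusion hD)
    (Subalgebra.inclusion_injective hD)).trans hrange

variable {κ σ : Type*}

theorem aeval_smul_of_isHomogeneous [CommSemiring k] {A : Type*} [CommSemiring A]
    [Algebra k A] {f : MvPolynomial σ k} {a : ℕ} (hf : f.IsHomogeneous a) (c : A) (p : σ → A) :
    aeval (c • p) f = c ^ a * aeval p f := by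
  rw [aeval_def, aeval_def, eval₂_eq, eval₂_eq, Finset.mul_sum]
  refine Finset.sum_congr rfl fun d hd => ?_
  have hd' : ∑ i ∈ d.support, d i = a := by
    rw [hf.degree_eq_sum_deg_support hd]
  simp only [Pi.smul_apply, smul_eq_mul, mul_pow, Finset.prod_mul_distrib,
    Finset.prod_pow_eq_pow_sum, hd']
  ring

theorem map_mulVec_eq_zero [Fintype σ] {R K : Type*} [CommRing R] [CommRing K] {M : Matrix κ σ R}
    {u : σ → R} (hu : M *ᵥ u = 0) (φ : R →+* K) : M.map φ *ᵥ (φ ∘ u) = 0 :=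
  funext fun j => by
    rw [← RingHom.map_mulVec, congrFun hu j, Pi.zero_apply, map_zero, Pi.zero_apply]

theorem eval_comp_kernelMatrix_mulVec [CommRing k] [Fintype σ] [DecidableEq σ] {r : ℕ}
    {ρ : Fin r → κ} {γ : Fin r → σ} {Ψ : Matrix κ σ (MvPolynomial σ k)} (hΨX : Ψ *ᵥ X = 0)
    (p : σ → k) :
    eval p ∘ (kernelMatrix Ψ ρ γ *ᵥ (C ∘ p)) = eval p (Ψ.submatrix ρ γ).det • p := by
  have hp : Ψ.map (eval p) *ᵥ p = 0 := by
    simpa [Function.comp_def] using map_mulVec_eq_zero hΨX (eval p)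
  have hCp : eval p ∘ C ∘ p = p := funext fun l => eval_C _
  have hmap : eval p ∘ (kernelMatrix Ψ ρ γ *ᵥ (C ∘ p)) =
      kernelMatrix (Ψ.map (eval p)) ρ γ *ᵥ p := by
    rw [← map_kernelMatrix]
    exact (_root_.funext (RingHom.map_mulVec (eval p) _ (C ∘ p))).trans (by rw [hCp])
  rw [hmap, kernelMatrix_mulVec_of_mulVec_eq_zero hp, RingHom.map_det]
  rfl

variable [CommRing k] [IsDomain k]

theorem isAlgebraic_polynomial_mvPolynomial {B : Type*} [CommRing B] [IsDomain B] [Algebra k B]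
    [Algebra B (Polynomial (MvPolynomial σ k))]
    [IsScalarTower k B (Polynomial (MvPolynomial σ k))]
    (hX : ∀ l, IsAlgebraic B (Polynomial.C (X l) : Polynomial (MvPolynomial σ k)))
    {f : MvPolynomial σ k} (hf : f ≠ 0) (hfX : IsAlgebraic B (Polynomial.monomial 1 f)) :
    Algebra.IsAlgebraic B (Polynomial (MvPolynomial σ k)) := by
  have hC (a : MvPolynomial σ k) : IsAlgebraic B (Polynomial.C a) := by
    induction a using MvPolynomial.induction_on with
    | C a =>
      have h := isAlgebraic_algebraMap (A := Polynomial (MvPolynomial σ k)) (algebraMap k B a)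
      rwa [← IsScalarTower.algebraMap_apply] at h
    | add a b ha hb => rw [map_add]; exact ha.add hb
    | mul_X a l ha => rw [map_mul]; exact ha.mul (hX l)
  have hT : IsAlgebraic B (Polynomial.X : Polynomial (MvPolynomial σ k)) := by
    rw [← Polynomial.C_mul_X_eq_monomial] at hfX
    exact .of_mul (mem_nonZeroDivisors_of_ne_zero (Polynomial.C_ne_zero.2 hf)) (hC f) hfX
  refine ⟨fun q => ?_⟩
  induction q using Polynomial.induction_on' with
  | add p q hp hq => exact hp.add hq
  | monomial j a => rw [← Polynomial.C_mul_X_pow_eq_monomial]; exact (hC a).mul (hT.pow j)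

variable {r : ℕ} {γ : Fin r → σ} {V : Submodule k (MvPolynomial σ k)}

theorem trdeg_coordinateRing_le_of_eq_aeval_mul {Q : Type*} [Field Q] [Algebra k Q]
    {φ : Polynomial (MvPolynomial σ k) →ₐ[k] Q} (hφ : Function.Injective φ) {y : σ → Q} {e : Q}
    (hy : ∀ l ∉ Set.range γ, y l ∈ Set.range (algebraMap k Q))
    (hφy : ∀ w ∈ V, φ (Polynomial.monomial 1 w) = aeval y w * e) :
    Algebra.trdeg k (coordinateRing V) ≤ r + 1 := by
  let z : Option (Fin r) → Q := fun o => o.elim e (y ∘ γ)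
  have hyz : Algebra.adjoin k (Set.range y) ≤ Algebra.adjoin k (Set.range z) := by
    rw [Algebra.adjoin_le_iff]
    rintro _ ⟨l, rfl⟩
    by_cases hl : l ∈ Set.range γ
    · obtain ⟨a, rfl⟩ := hl
      exact Algebra.subset_adjoin ⟨some a, rfl⟩
    · obtain ⟨a, ha⟩ := hy l hl
      exact ha ▸ Subalgebra.algebraMap_mem _ a
  have hle : (coordinateRing V).map φ ≤ Algebra.adjoin k (Set.range z) := by
    rw [coordinateRing, AlgHom.map_adjoin, Algebra.adjoin_le_iff]
    rintro _ ⟨_, ⟨w, hw, rfl⟩, rfl⟩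
    rw [hφy w hw]
    refine mul_mem (hyz ?_) (Algebra.subset_adjoin ⟨none, rfl⟩)
    rw [Algebra.adjoin_range_eq_range_aeval]
    exact ⟨w, rfl⟩
  have htrdeg := ((coordinateRing V).equivMapOfInjective φ hφ).lift_trdeg_eq
  have hbound := lift_le.2 (trdeg_le_of_le_adjoin hle)
  rw [← htrdeg] at hbound
  refine lift_le.1 (hbound.trans_eq ?_)
  simp

theorem trdeg_coordinateRing_le_of_section {δ : ℕ} (hV : V ≤ homogeneousSubmodule σ k δ)
    {f Δ : MvPolynomial σ k} (hΔ : Δ ≠ 0) {p : σ → k} {u : σ → MvPolynomial σ k}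
    (huf : aeval u f ≠ 0) (hu : ∀ w ∈ V, aeval u w * f = aeval u f * w)
    (huγ : ∀ l ∉ Set.range γ, u l = Δ * C (p l)) :
    Algebra.trdeg k (coordinateRing V) ≤ r + 1 := by
  let Q := FractionRing (Polynomial (MvPolynomial σ k))
  let φ : Polynomial (MvPolynomial σ k) →ₐ[k] Q := IsScalarTower.toAlgHom k _ Q
  have hφ : Function.Injective φ := IsFractionRing.injective _ Q
  let c : MvPolynomial σ k →ₐ[k] Q := φ.comp Polynomial.CAlgHom
  have hc : Function.Injective c := hφ.comp Polynomial.C_injective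
  have hcΔ : c Δ ≠ 0 := (map_ne_zero_iff c hc).2 hΔ
  have hcuf : c (aeval u f) ≠ 0 := (map_ne_zero_iff c hc).2 huf
  let y : σ → Q := (c Δ)⁻¹ • c ∘ u
  refine trdeg_coordinateRing_le_of_eq_aeval_mul (γ := γ) hφ (y := y)
    (e := c f * φ Polynomial.X * c Δ ^ δ / c (aeval u f)) (fun l hl => ⟨p l, ?_⟩) fun w hw => ?_
  · change _ = (c Δ)⁻¹ * c (u l)
    rw [huγ l hl, map_mul, inv_mul_cancel_left₀ hcΔ]
    exact (c.commutes (p l)).symm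
  · have hcu : c (aeval u w) = c Δ ^ δ * aeval y w := by
      rw [← aeval_smul_of_isHomogeneous (hV hw), smul_inv_smul₀ hcΔ, comp_aeval_apply]
      rfl
    have huw := congrArg c (hu w hw)
    rw [map_mul, map_mul, hcu] at huw
    have hφw : φ (Polynomial.monomial 1 w) = c w * φ Polynomial.X := by
      rw [← Polynomial.C_mul_X_eq_monomial]
      exact map_mul φ _ _
    rw [mul_div_assoc', eq_div_iff hcuf, hφw]
    linear_combination -φ Polynomial.X * huw

variable [Fintype σ] {ρ : Fin r → κ} {Ψ : Matrix κ σ (MvPolynomial σ k)}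

theorem det_mul_eq_neg_sum_of_mulVec_eq_zero {P : Type*} [CommRing P] [DecidableEq σ]
    {N : Matrix κ σ P} (hγ : Function.Injective γ) {y : σ → P} (hy : N *ᵥ y = 0) (a : Fin r) :
    (N.submatrix ρ γ).det * y (γ a) = -∑ l ∈ (Finset.univ.image γ)ᶜ,
      ((N.submatrix ρ γ).adjugate * N.submatrix ρ id) a l * y l := by
  have hrows : N.submatrix ρ id *ᵥ y = 0 := funext fun i => congrFun hy (ρ i)
  have hsum : ∑ l, ((N.submatrix ρ γ).adjugate * N.submatrix ρ id) a l * y l = 0 := by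
    have h := congrArg ((N.submatrix ρ γ).adjugate *ᵥ ·) hrows
    rw [mulVec_mulVec, mulVec_zero] at h
    exact congrFun h a
  have hcols (b : Fin r) : ((N.submatrix ρ γ).adjugate * N.submatrix ρ id) a (γ b) =
      ((N.submatrix ρ γ).det • (1 : Matrix (Fin r) (Fin r) P)) a b := by
    rw [← adjugate_mul]
    rfl
  rw [← Finset.sum_add_sum_compl (Finset.univ.image γ), Finset.sum_image hγ.injOn] at hsum
  simp only [hcols, Matrix.smul_apply, one_apply, smul_eq_mul, mul_ite, mul_one, mul_zero, ite_mul,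
    zero_mul, Finset.sum_ite_eq, Finset.mem_univ, if_true] at hsum
  exact eq_neg_of_add_eq_zero_left hsum

theorem isAlgebraic_adjoin_of_mulVec_eq_zero {D P : Type*} [CommRing D] [CommRing P] [IsDomain P]
    [Algebra D P] {M : Matrix κ σ D} (hγ : Function.Injective γ) {y : σ → P}
    (hy : M.map (algebraMap D P) *ᵥ y = 0)
    (hdet : algebraMap D P (M.submatrix ρ γ).det ≠ 0) (l : σ) :
    IsAlgebraic (Algebra.adjoin D (y '' (Set.range γ)ᶜ)) (y l) := by
  classical
  have hmem {x : P} (hx : x ∈ Algebra.adjoin D (y '' (Set.range γ)ᶜ)) :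
      IsAlgebraic (Algebra.adjoin D (y '' (Set.range γ)ᶜ)) x :=
    isAlgebraic_algebraMap (⟨x, hx⟩ : Algebra.adjoin D (y '' (Set.range γ)ᶜ))
  by_cases hl : l ∈ Set.range γ
  swap
  · exact hmem (Algebra.subset_adjoin ⟨l, hl, rfl⟩)
  obtain ⟨a, rfl⟩ := hl
  have hcramer := det_mul_eq_neg_sum_of_mulVec_eq_zero (ρ := ρ) hγ hy a
  have hmap : ((M.map (algebraMap D P)).submatrix ρ γ).adjugate *
      (M.map (algebraMap D P)).submatrix ρ id =
      ((M.submatrix ρ γ).adjugate * M.submatrix ρ id).map (algebraMap D P) := by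
    rw [Matrix.map_mul]
    exact congrArg (· * _) ((algebraMap D P).map_adjugate _).symm
  have hdet' : ((M.map (algebraMap D P)).submatrix ρ γ).det =
      algebraMap D P (M.submatrix ρ γ).det := ((algebraMap D P).map_det _).symm
  rw [hmap, hdet'] at hcramer
  refine IsAlgebraic.of_mul (mem_nonZeroDivisors_of_ne_zero hdet)
    (hmem (Subalgebra.algebraMap_mem _ _)) (hmem ?_)
  rw [hcramer]
  refine neg_mem (sum_mem fun l hl => mul_mem (Subalgebra.algebraMap_mem _ _)
    (Algebra.subset_adjoin ⟨l, ?_, rfl⟩))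
  simpa using hl

theorem isAlgebraic_adjoin_of_monomial_eq {D : Type*} [CommRing D] [Algebra k D]
    [Algebra D (Polynomial (MvPolynomial σ k))] [IsScalarTower k D (Polynomial (MvPolynomial σ k))]
    {M : Matrix κ σ D} (hM : ∀ j l, algebraMap D _ (M j l) = Polynomial.monomial 1 (Ψ j l))
    (hΨX : Ψ *ᵥ X = 0) (h : IsRankMinor Ψ ρ γ) {f : MvPolynomial σ k} (hf : f ≠ 0)
    {φ : D} (hφ : algebraMap D _ φ = Polynomial.monomial 1 f) :
    Algebra.IsAlgebraic (Algebra.adjoin D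
      ((fun l => (Polynomial.C (X l) : Polynomial (MvPolynomial σ k))) '' (Set.range γ)ᶜ))
      (Polynomial (MvPolynomial σ k)) := by
  have hMΨ : M.map (algebraMap D (Polynomial (MvPolynomial σ k))) =
      (Polynomial.X : Polynomial (MvPolynomial σ k)) • Ψ.map Polynomial.C :=
    Matrix.ext fun j l => by
      rw [Matrix.map_apply, hM, ← Polynomial.C_mul_X_eq_monomial, mul_comm]
      rfl
  have hMX : M.map (algebraMap D (Polynomial (MvPolynomial σ k))) *ᵥ
      (fun l => Polynomial.C (X l)) = 0 := by
    funext j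
    have hj := congrArg Polynomial.C (congrFun hΨX j)
    rw [RingHom.map_mulVec, Pi.zero_apply, map_zero] at hj
    rw [hMΨ, smul_mulVec, Pi.smul_apply]
    exact (congrArg _ hj).trans (smul_zero _)
  have hdet : algebraMap D (Polynomial (MvPolynomial σ k)) (M.submatrix ρ γ).det ≠ 0 := by
    have hsub : (algebraMap D (Polynomial (MvPolynomial σ k))).mapMatrix (M.submatrix ρ γ) =
        (Polynomial.X : Polynomial (MvPolynomial σ k)) •
          Polynomial.C.mapMatrix (Ψ.submatrix ρ γ) := congrArg (·.submatrix ρ γ) hMΨ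
    rw [RingHom.map_det, hsub, det_smul, ← RingHom.map_det]
    exact mul_ne_zero (pow_ne_zero _ Polynomial.X_ne_zero) (Polynomial.C_ne_zero.2 h.det_ne_zero)
  refine isAlgebraic_polynomial_mvPolynomial
    (isAlgebraic_adjoin_of_mulVec_eq_zero h.injective hMX hdet) hf ?_
  rw [← hφ]
  exact isAlgebraic_algebraMap (algebraMap D (Algebra.adjoin D _) φ)

theorem trdeg_polynomial_mvPolynomial :
    Algebra.trdeg k (Polynomial (MvPolynomial σ k)) = Fintype.card σ + 1 := by
  rw [← trdeg_add_eq k (MvPolynomial σ k), MvPolynomial.trdeg_of_isDomain,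
    Polynomial.trdeg_of_isDomain, mk_fintype, lift_natCast]

theorem add_one_le_trdeg_coordinateRing (hΨV : ∀ j l, Ψ j l ∈ V) (hΨX : Ψ *ᵥ X = 0)
    (h : IsRankMinor Ψ ρ γ) {f : MvPolynomial σ k} (hf : f ∈ V) (hf0 : f ≠ 0) :
    (r + 1 : Cardinal) ≤ Algebra.trdeg k (coordinateRing V) := by
  classical
  let P := Polynomial (MvPolynomial σ k)
  let s : Set P := (fun l => Polynomial.C (X l)) '' (Set.range γ)ᶜ
  let M : Matrix κ σ (coordinateRing V) :=
    .of fun j l => ⟨Polynomial.monomial 1 (Ψ j l), monomial_mem_coordinateRing (hΨV j l)⟩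
  have halg : Algebra.IsAlgebraic (Algebra.adjoin (coordinateRing V) s) P :=
    isAlgebraic_adjoin_of_monomial_eq (M := M) (fun _ _ => rfl) hΨX h hf0
      (φ := ⟨_, monomial_mem_coordinateRing hf⟩) rfl
  have hs : Algebra.trdeg (coordinateRing V) P ≤ (Fintype.card σ - r : ℕ) := by
    refine halg.trdeg_le_cardinalMk.trans (lift_le.1 (mk_image_le_lift.trans_eq ?_))
    rw [mk_fintype, Fintype.card_compl_set, Set.card_range_of_injective h.injective,
      Fintype.card_fin, lift_natCast, lift_natCast]
  have hr : r ≤ Fintype.card σ := by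
    simpa using Fintype.card_le_of_injective γ h.injective
  have hadd : Algebra.trdeg k (coordinateRing V) + Algebra.trdeg (coordinateRing V) P =
      Fintype.card σ + 1 := (trdeg_add_eq k _).trans trdeg_polynomial_mvPolynomial
  refine (add_le_add_iff_of_lt_aleph0 (natCast_lt_aleph0 (n := Fintype.card σ - r))).1 ?_
  calc (r + 1 : Cardinal) + (Fintype.card σ - r : ℕ) = Fintype.card σ + 1 := by
        norm_cast
        lia
    _ ≤ Algebra.trdeg k (coordinateRing V) + (Fintype.card σ - r : ℕ) := by
        rw [← hadd]
        gcongr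

/-- A polynomial section of the rational map defined by `V`, obtained by intersecting its fibres,
the kernels of `Ψ`, with the linear space through a general point `p` on which the coordinates
outside `γ` are proportional to those of `p`. -/
theorem exists_section [Infinite k] {δ : ℕ} (hV : V ≤ homogeneousSubmodule σ k δ)
    (hΨX : Ψ *ᵥ X = 0)
    (hfib : ∀ p y : σ → k, Ψ.map (eval p) *ᵥ y = 0 →
      ∀ v ∈ V, ∀ w ∈ V, eval y v * eval p w = eval y w * eval p v)
    (h : IsRankMinor Ψ ρ γ) {f : MvPolynomial σ k} (hf : f ∈ V) (hf0 : f ≠ 0) :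
    ∃ (p : σ → k) (u : σ → MvPolynomial σ k), aeval u f ≠ 0 ∧
      (∀ w ∈ V, aeval u w * f = aeval u f * w) ∧
      ∀ l ∉ Set.range γ, u l = (Ψ.submatrix ρ γ).det * C (p l) := by
  classical
  obtain ⟨p, hp⟩ : ∃ p, eval p ((Ψ.submatrix ρ γ).det * f) ≠ 0 := by
    by_contra! hzero
    exact mul_ne_zero h.det_ne_zero hf0 (MvPolynomial.funext fun p => by simpa using hzero p)
  rw [map_mul, mul_ne_zero_iff] at hp
  let u := kernelMatrix Ψ ρ γ *ᵥ (C ∘ p)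
  have heval (q : σ → k) (w : MvPolynomial σ k) :
      eval q (aeval u w) = eval (eval q ∘ u) w := by
    simpa only [← aeval_eq_eval] using! comp_aeval_apply u (aeval q) w
  refine ⟨p, u, fun hzero => ?_, fun w hw => MvPolynomial.funext fun q => ?_,
    fun l hl => kernelMatrix_mulVec_apply hl _⟩
  · have h0 := congrArg (eval p) hzero
    rw [heval, eval_comp_kernelMatrix_mulVec hΨX, ← aeval_eq_eval,
      aeval_smul_of_isHomogeneous (hV hf), aeval_eq_eval, map_zero] at h0
    exact mul_ne_zero (pow_ne_zero δ hp.1) hp.2 h0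
  · have hΨu : Ψ *ᵥ u = 0 := by
      rw [mulVec_mulVec, mul_kernelMatrix h, zero_mulVec]
    rw [map_mul, map_mul, heval, heval]
    exact hfib q _ (map_mulVec_eq_zero hΨu (eval q)) w hw f hf

theorem trdeg_coordinateRing_eq_add_one [Infinite k] {δ : ℕ}
    (hV : V ≤ homogeneousSubmodule σ k δ) (hV0 : V ≠ ⊥) (hΨV : ∀ j l, Ψ j l ∈ V)
    (hΨX : Ψ *ᵥ X = 0)
    (hfib : ∀ p y : σ → k, Ψ.map (eval p) *ᵥ y = 0 →
      ∀ v ∈ V, ∀ w ∈ V, eval y v * eval p w = eval y w * eval p v)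
    (h : IsRankMinor Ψ ρ γ) : Algebra.trdeg k (coordinateRing V) = r + 1 := by
  obtain ⟨f, hf, hf0⟩ := V.exists_mem_ne_zero_of_ne_bot hV0
  obtain ⟨p, u, huf, hu, huγ⟩ := exists_section hV hΨX hfib h hf hf0
  exact le_antisymm (trdeg_coordinateRing_le_of_section hV h.det_ne_zero huf hu huγ)
    (add_one_le_trdeg_coordinateRing hΨV hΨX h hf hf0)

end CoordinateRing

section Homogeneous

variable {k σ : Type*} [CommRing k]

theorem mem_pow_idealOfVars_of_isHomogeneous {f : MvPolynomial σ k} {a : ℕ}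
    (hf : f.IsHomogeneous a) : f ∈ idealOfVars σ k ^ a :=
  (mem_pow_idealOfVars_iff' a f).2 fun _ he => hf.coeff_eq_zero he.ne

theorem eq_zero_of_isHomogeneous_of_mem_pow_idealOfVars {f : MvPolynomial σ k} {a e : ℕ}
    (hf : f.IsHomogeneous a) (hfe : f ∈ idealOfVars σ k ^ e) (hae : a < e) : f = 0 := by
  ext x
  by_cases hx : x.degree = a
  · exact (mem_pow_idealOfVars_iff' e f).1 hfe x (hx ▸ hae)
  · exact hf.coeff_eq_zero hx

theorem homogeneousComponent_mul_of_isHomogeneous (f : MvPolynomial σ k) {g : MvPolynomial σ k}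
    {a : ℕ} (hg : g.IsHomogeneous a) (e : ℕ) :
    homogeneousComponent e (f * g) = if a ≤ e then homogeneousComponent (e - a) f * g else 0 := by
  let := gradedAlgebra (σ := σ) (R := k)
  have := DirectSum.coe_decompose_mul_of_right_mem (homogeneousSubmodule σ k) (a := f) e hg
  rw [← decomposition.decompose'_apply, ← decomposition.decompose'_apply]
  exact this

theorem homogeneousComponent_mul_add (f : MvPolynomial σ k) {g : MvPolynomial σ k}
    {a : ℕ} (hg : g.IsHomogeneous a) (e : ℕ) :
    homogeneousComponent (a + e) (f * g) = homogeneousComponent e f * g := by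
  rw [homogeneousComponent_mul_of_isHomogeneous f hg, if_pos (Nat.le_add_right a e),
    Nat.add_sub_cancel_left]

theorem pow_le_homogeneousSubmodule {W : Submodule k (MvPolynomial σ k)} {δ : ℕ}
    (hW : W ≤ homogeneousSubmodule σ k δ) (d : ℕ) : W ^ d ≤ homogeneousSubmodule σ k (d * δ) := by
  induction d with
  | zero => simp
  | succ d ih =>
    rw [pow_succ, Nat.succ_mul]
    exact Submodule.mul_le.2 fun x hx y hy => (ih hx).mul (hW hy)

theorem ker_linearCombination_eq_span_homogeneous {ι : Type*} [Fintype ι]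
    {b : ι → MvPolynomial σ k} {D : ℕ} (hb : ∀ i, (b i).IsHomogeneous D) :
    LinearMap.ker (Fintype.linearCombination (MvPolynomial σ k) b) =
      Submodule.span (MvPolynomial σ k)
        {v | ∑ i, v i * b i = 0 ∧ ∃ e, ∀ i, (v i).IsHomogeneous e} := by
  refine le_antisymm (fun v hv => ?_) (Submodule.span_le.2 fun v hv => hv.1)
  have hv_sum : v = ∑ e ∈ Finset.range (Finset.univ.sup (fun i => (v i).totalDegree) + 1),
      fun i => homogeneousComponent e (v i) := by
    ext1 i
    have hdegree : (v i).totalDegree ≤ Finset.univ.sup fun i => (v i).totalDegree :=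
      Finset.le_sup (f := fun i => (v i).totalDegree) (Finset.mem_univ i)
    rw [Finset.sum_apply, ← Finset.sum_subset
      (Finset.range_mono (Nat.succ_le_succ hdegree)), sum_homogeneousComponent]
    intro e _ he
    exact homogeneousComponent_eq_zero _ _ (by simpa using he)
  rw [hv_sum]
  refine Submodule.sum_mem _ fun e _ => Submodule.subset_span
    ⟨?_, e, fun i => homogeneousComponent_isHomogeneous e (v i)⟩
  have hcomponent := congrArg (homogeneousComponent (D + e))
    (show ∑ i, v i * b i = 0 from hv)
  simpa only [map_sum, map_zero, homogeneousComponent_mul_add _ (hb _)] using hcomponent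

end Homogeneous

theorem idealSpan_pow {k S : Type*} [CommSemiring k] [CommSemiring S] [Algebra k S]
    (W : Submodule k S) (d : ℕ) :
    Ideal.span (W : Set S) ^ d = Ideal.span ((W ^ d : Submodule k S) : Set S) := by
  rw [Ideal.span, Submodule.span_pow, W.pow_eq_span_pow_set, Ideal.span,
    Submodule.span_span_of_tower]

section Presentations

variable {k : Type*} [Field k] {n m c : ℕ} {I : Ideal (MvPolynomial (Fin (n + 1)) k)}
  {g : Fin m → MvPolynomial (Fin (n + 1)) k}
  {A : Matrix (Fin m) (Fin c) (MvPolynomial (Fin (n + 1)) k)}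

theorem exists_isHomogeneousPresentation {b : Fin m → MvPolynomial (Fin (n + 1)) k} {D : ℕ}
    (hb : ∀ i, (b i).IsHomogeneous D) (hmin : ∀ i, b i ∉ Ideal.span (b '' {j | j ≠ i})) :
    ∃ (c : ℕ) (A : Matrix (Fin m) (Fin c) (MvPolynomial (Fin (n + 1)) k)),
      IsHomogeneousPresentation (Ideal.span (Set.range b)) b A := by
  have hfg := IsNoetherian.noetherian
    (LinearMap.ker (Fintype.linearCombination (MvPolynomial (Fin (n + 1)) k) b))
  have hspan := ker_linearCombination_eq_span_homogeneous hb
  rw [hspan, Submodule.fg_span_iff_fg_span_finset_subset] at hfg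
  obtain ⟨T, hT, hT_span⟩ := hfg
  obtain ⟨c, column, hcolumn⟩ := T.finite_toSet.fin_embedding
  have hcolumn_mem : ∀ j, column j ∈ T := fun j =>
    Finset.mem_coe.1 (hcolumn ▸ Set.mem_range_self j)
  choose e he using fun j => (hT (hcolumn_mem j)).2
  refine ⟨c, .of fun i j => column j i, rfl, hmin,
    ⟨fun _ => D, fun j => D + e j, hb, fun i j _ => ⟨e j, rfl, he j i⟩⟩, fun v => ?_⟩
  change v ∈ LinearMap.ker (Fintype.linearCombination _ b) ↔
    v ∈ Submodule.span _ (Set.range column)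
  rw [hspan, hT_span, hcolumn]

theorem IsLinearlyPresented.hasLinearGeneralizedRowIdeals (h : IsLinearlyPresented I) :
    HasLinearGeneralizedRowIdeals I := by
  obtain ⟨m, c, g, A, hA, hlin⟩ := h
  refine ⟨m, c, g, A, hA, fun q _ => ⟨_, ?_, rfl⟩⟩
  rintro _ ⟨j, rfl⟩
  exact .sum _ _ _ fun i _ => (hlin i j).C_mul (q i)

namespace IsHomogeneousPresentation

theorem isHomogeneous (h : IsHomogeneousPresentation I g A)
    {W : Set (MvPolynomial (Fin (n + 1)) k)} {δ : ℕ} (hW : ∀ w ∈ W, w.IsHomogeneous δ)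
    (hI : I = Ideal.span W) (i : Fin m) :
    (g i).IsHomogeneous δ := by
  obtain ⟨a, -, ha, -⟩ := h.homogeneous
  have hg_mem : g i ∈ Ideal.span W :=
    hI ▸ h.span_eq ▸ Ideal.subset_span (Set.mem_range_self i)
  have hδ_le : δ ≤ a i := by
    by_contra! hlt
    have hW_le : Ideal.span W ≤ idealOfVars _ k ^ δ :=
      Ideal.span_le.2 fun w hw => mem_pow_idealOfVars_of_isHomogeneous (hW w hw)
    have hg_zero := eq_zero_of_isHomogeneous_of_mem_pow_idealOfVars (ha i) (hW_le hg_mem) hlt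
    exact h.minimal i (hg_zero ▸ zero_mem _)
  obtain hδ | hδ := hδ_le.eq_or_lt
  · exact hδ ▸ ha i
  -- If `g i` had degree larger than `δ`, the forms in `W` would not involve it.
  refine absurd (Ideal.span_le.2 (fun w hw => ?_) hg_mem) (h.minimal i)
  obtain ⟨v, hv⟩ := Ideal.mem_span_range_iff_exists_fun.1
    (show w ∈ Ideal.span (Set.range g) from h.span_eq ▸ hI ▸ Ideal.subset_span hw)
  rw [SetLike.mem_coe, ← homogeneousComponent_eq_self (hW w hw), ← hv, map_sum]
  refine Submodule.sum_mem _ fun j _ => ?_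
  rw [homogeneousComponent_mul_of_isHomogeneous _ (ha j)]
  split_ifs with hj
  · exact Ideal.mul_mem_left _ _ (Ideal.subset_span ⟨j, fun hji => by lia, rfl⟩)
  · exact zero_mem _

end IsHomogeneousPresentation

end Presentations

section SpecialFiber

variable {S : Type*} [CommRing S]

theorem coeff_mem_of_mem_coordinateRing {k : Type*} [CommRing k] [Algebra k S] {V : Submodule k S}
    {q : Polynomial S} (hq : q ∈ coordinateRing V) (d : ℕ) :
    q.coeff d ∈ V ^ d := by
  induction hq using Algebra.adjoin_induction generalizing d with
  | mem q hq =>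
    obtain ⟨w, hw, rfl⟩ := hq
    rw [Polynomial.coeff_monomial]
    split_ifs with hd
    · rwa [← hd, pow_one]
    · exact zero_mem _
  | algebraMap a =>
    rw [Polynomial.algebraMap_apply, Polynomial.coeff_C]
    split_ifs with hd
    · rw [hd, pow_zero]
      exact Submodule.algebraMap_mem a
    · exact zero_mem _
  | add p q _ _ hp hq => exact add_mem (hp d) (hq d)
  | mul p q _ _ hp hq =>
    rw [Polynomial.coeff_mul]
    refine sum_mem fun ij hij => ?_
    rw [← Finset.HasAntidiagonal.mem_antidiagonal.1 hij, pow_add]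
    exact Submodule.mul_mem_mul (hp ij.1) (hq ij.2)

theorem reesAlgebra_span (s : Set S) :
    reesAlgebra (Ideal.span s) = Algebra.adjoin S (Polynomial.monomial 1 '' s) := by
  rw [← adjoin_monomial_eq_reesAlgebra, Ideal.span, Submodule.map_span, Algebra.adjoin_span]

theorem coeff_mem_of_mem_map_reesAlgebra {I J : Ideal S} {z : reesAlgebra I}
    (hz : z ∈ J.map (algebraMap S (reesAlgebra I))) (d : ℕ) :
    (z : Polynomial S).coeff d ∈ J * I ^ d := by
  induction hz using Submodule.span_induction generalizing d with
  | mem z hz =>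
    obtain ⟨x, hx, rfl⟩ := hz
    change (Polynomial.C x).coeff d ∈ _
    rw [Polynomial.coeff_C]
    split_ifs with hd
    · subst hd
      simpa using hx
    · exact zero_mem _
  | zero => simp
  | add x y _ _ hx hy => exact add_mem (hx d) (hy d)
  | smul a x _ hx =>
    change ((a : Polynomial S) * (x : Polynomial S)).coeff d ∈ _
    rw [Polynomial.coeff_mul]
    refine Submodule.sum_mem _ fun ij hij => ?_
    rw [← Finset.HasAntidiagonal.mem_antidiagonal.1 hij, pow_add, mul_left_comm]
    exact Ideal.mul_mem_mul (a.2 ij.1) (hx ij.2)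

theorem ringKrullDim_quotient_map_eq {k P : Type*} [CommRing k] [Algebra k S] [CommRing P]
    [Algebra S P] [Algebra k P] [IsScalarTower k S P] {D : Subalgebra k P}
    {R : Subalgebra S P} {𝔪 : Ideal S} (hR : R = Algebra.adjoin S D)
    (h𝔪 : ∀ s, ∃ a, algebraMap k S a - s ∈ 𝔪)
    (hD : ∀ z ∈ 𝔪.map (algebraMap S R), (z : P) ∈ D → z = 0) :
    ringKrullDim (R ⧸ 𝔪.map (algebraMap S R)) = ringKrullDim D := by
  have hadj : Algebra.adjoin S D ≤ R := hR.ge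
  let π : D →+* R ⧸ 𝔪.map (algebraMap S R) := (Ideal.Quotient.mk _).comp
    (Subalgebra.inclusion (T := R.restrictScalars k)
      fun q hq => hadj (Algebra.subset_adjoin hq)).toRingHom
  have hinj : Function.Injective π := (injective_iff_map_eq_zero π).2 fun q hq =>
    Subalgebra.inclusion_injective _ (hD _ (Ideal.Quotient.eq_zero_iff_mem.1 hq) q.2)
  have hadjoin (q : P) (hq : q ∈ Algebra.adjoin S (D : Set P)) :
      Ideal.Quotient.mk (𝔪.map (algebraMap S R)) ⟨q, hadj hq⟩ ∈ π.range := by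
    induction hq using Algebra.adjoin_induction with
    | mem q hq => exact ⟨⟨q, hq⟩, rfl⟩
    | algebraMap s =>
      obtain ⟨a, ha⟩ := h𝔪 s
      refine ⟨algebraMap k D a, Ideal.Quotient.eq.2 ?_⟩
      convert Ideal.mem_map_of_mem (algebraMap S R) ha
      rw [map_sub]
      congr 1
      exact Subtype.ext (IsScalarTower.algebraMap_apply k S P a)
    | add p q _ _ hp hq => exact add_mem hp hq
    | mul p q _ _ hp hq => exact mul_mem hp hq
  have hsurj : Function.Surjective π := fun z => by
    obtain ⟨q, rfl⟩ := Ideal.Quotient.mk_surjective z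
    exact hadjoin q (hR.le q.2)
  exact (ringKrullDim_eq_of_ringEquiv (RingEquiv.ofBijective π ⟨hinj, hsurj⟩)).symm

theorem finiteType_coordinateRing {k : Type*} [CommRing k] [Algebra k S] {V : Submodule k S}
    (hV : V.FG) : Algebra.FiniteType k (coordinateRing V) := by
  obtain ⟨s, hs, rfl⟩ := Submodule.fg_def.1 hV
  refine (Subalgebra.fg_iff_finiteType _).1 (Subalgebra.fg_def.2
    ⟨Polynomial.monomial 1 '' s, hs.image _, ?_⟩)
  have hspan : (Submodule.span k (Polynomial.monomial 1 '' s) : Set (Polynomial S)) =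
      Polynomial.monomial 1 '' (Submodule.span k s) :=
    congrArg SetLike.coe (Submodule.map_span ((Polynomial.monomial 1).restrictScalars k) s).symm
  rw [coordinateRing, ← hspan, Algebra.adjoin_span]

theorem C_constantCoeff_sub_mem_idealOfVars {k σ : Type*} [CommRing k] (s : MvPolynomial σ k) :
    C (constantCoeff s) - s ∈ idealOfVars σ k := by
  rw [← pow_one (idealOfVars σ k), mem_pow_idealOfVars_iff']
  intro x hx
  rw [(Finsupp.degree_eq_zero_iff x).1 (Nat.lt_one_iff.1 hx)]
  simp [constantCoeff_eq]

theorem analyticSpread_span {k : Type*} [Field k] {n δ : ℕ}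
    {V : Submodule k (MvPolynomial (Fin (n + 1)) k)}
    (hV : V ≤ homogeneousSubmodule (Fin (n + 1)) k δ) :
    analyticSpread (Ideal.span (V : Set (MvPolynomial (Fin (n + 1)) k))) =
      ringKrullDim (coordinateRing V) := by
  have hI : Ideal.span (V : Set (MvPolynomial (Fin (n + 1)) k)) ≤
      idealOfVars (Fin (n + 1)) k ^ δ :=
    Ideal.span_le.2 fun w hw => mem_pow_idealOfVars_of_isHomogeneous (hV hw)
  refine ringKrullDim_quotient_map_eq
    ((reesAlgebra_span _).trans (Algebra.adjoin_adjoin_of_tower k _).symm)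
    (fun s => ⟨_, C_constantCoeff_sub_mem_idealOfVars s⟩)
    fun z hz hzD => Subtype.ext (Polynomial.ext fun d => ?_)
  refine eq_zero_of_isHomogeneous_of_mem_pow_idealOfVars (e := d * δ + 1)
    (pow_le_homogeneousSubmodule hV d (coeff_mem_of_mem_coordinateRing hzD d)) ?_
    (Nat.lt_succ_self _)
  rw [pow_succ', mul_comm d, pow_mul]
  exact Ideal.mul_mono_right (Ideal.pow_right_mono hI d) (coeff_mem_of_mem_map_reesAlgebra hz d)

end SpecialFiber

section PointedSpaces

variable {k S : Type*} [CommRing k] [CommRing S] [Algebra k S] {W : Submodule k S}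
  {ε : S →ₐ[k] k} {w : S}

/-- The ideal generated by the elements of `W` vanishing at the `k`-rational point `ε`. -/
def vanishingIdeal (W : Submodule k S) (ε : S →ₐ[k] k) : Ideal S :=
  Ideal.span (W ⊓ LinearMap.ker ε.toLinearMap : Submodule k S)

theorem mem_vanishingIdeal {u : S} (hu : u ∈ W) (hεu : ε u = 0) : u ∈ vanishingIdeal W ε :=
  Ideal.subset_span ⟨hu, hεu⟩

theorem vanishingIdeal_le_iff {J : Ideal S} :
    vanishingIdeal W ε ≤ J ↔ ∀ u ∈ W, ε u = 0 → u ∈ J := by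
  simp [vanishingIdeal, Ideal.span_le, Set.subset_def]

theorem vanishingIdeal_le_ker : vanishingIdeal W ε ≤ RingHom.ker ε :=
  vanishingIdeal_le_iff.2 fun _ _ => id

theorem sub_mem_vanishingIdeal_pow (hw : w ∈ W) (hεw : ε w = 1) {d : ℕ} {u : S} (hu : u ∈ W ^ d) :
    u - algebraMap k S (ε u) * w ^ d ∈ vanishingIdeal W ε := by
  induction hu using Submodule.pow_induction_on_left' with
  | algebraMap r => simp
  | add x y d _ _ hx hy =>
    convert add_mem hx hy using 1
    rw [map_add, map_add]
    ring
  | mem_mul x hx d y _ hy =>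
    have hx' : x - algebraMap k S (ε x) * w ∈ vanishingIdeal W ε := by
      refine mem_vanishingIdeal ?_ (by simp [hεw])
      rw [← Algebra.smul_def]
      exact sub_mem hx (W.smul_mem _ hw)
    convert add_mem (Ideal.mul_mem_right y _ hx')
      (Ideal.mul_mem_left _ (algebraMap k S (ε x) * w) hy) using 1
    rw [map_mul, map_mul, Nat.succ_eq_add_one]
    ring

theorem vanishingIdeal_pow_le (hw : w ∈ W) (hεw : ε w = 1) (d : ℕ) :
    vanishingIdeal (W ^ d) ε ≤ vanishingIdeal W ε :=
  vanishingIdeal_le_iff.2 fun u hu hεu => by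
    simpa [hεu] using sub_mem_vanishingIdeal_pow hw hεw hu

theorem colon_vanishingIdeal_le_ker (hεw : ε w = 1) :
    (vanishingIdeal W ε).colon {w} ≤ RingHom.ker ε := fun f hf => by
  simpa [hεw] using! vanishingIdeal_le_ker (Submodule.mem_colon_singleton.1 hf)

theorem vanishingIdeal_le_colon_pow (hw : w ∈ W) (d : ℕ) :
    vanishingIdeal W ε ≤ (vanishingIdeal (W ^ (d + 1)) ε).colon {w ^ d} :=
  vanishingIdeal_le_iff.2 fun u hu hεu => Submodule.mem_colon_singleton.2 <| by
    refine mem_vanishingIdeal ?_ (by simp [hεu])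
    rw [pow_succ', smul_eq_mul]
    exact Submodule.mul_mem_mul hu (Submodule.pow_mem_pow _ hw d)

theorem colon_vanishingIdeal_pow [Nontrivial k] (hw : w ∈ W) (hεw : ε w = 1)
    (hprime : ((vanishingIdeal W ε).colon {w}).IsPrime) {d : ℕ} (hd : d ≠ 0) {b : S}
    (hb : b ∈ W ^ d) (hεb : ε b = 1) :
    (vanishingIdeal (W ^ d) ε).colon {b} = (vanishingIdeal W ε).colon {w} := by
  ext f
  obtain ⟨d, rfl⟩ := Nat.exists_eq_succ_of_ne_zero hd
  constructor <;> intro hf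
  · have hfb : f * b ∈ (vanishingIdeal W ε).colon {w} := Ideal.le_colon
      (vanishingIdeal_pow_le hw hεw _ (Submodule.mem_colon_singleton.1 hf))
    refine (hprime.mem_or_mem hfb).resolve_right fun hbJ => one_ne_zero (α := k) ?_
    exact hεb.symm.trans (colon_vanishingIdeal_le_ker hεw hbJ)
  · rw [Submodule.mem_colon_singleton] at hf ⊢
    have hfw : f * w ^ (d + 1) ∈ vanishingIdeal (W ^ (d + 1)) ε := by
      rw [pow_succ' w, ← mul_assoc]
      exact Submodule.mem_colon_singleton.1 (vanishingIdeal_le_colon_pow hw d hf)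
    have hbw : b - w ^ (d + 1) ∈ vanishingIdeal (W ^ (d + 1)) ε :=
      mem_vanishingIdeal (sub_mem hb (Submodule.pow_mem_pow _ hw _)) (by simp [hεb, hεw])
    simpa [mul_sub] using add_mem (Ideal.mul_mem_left _ f hbw) hfw

theorem exists_sum_mul_eq_of_mem_vanishingIdeal {ι : Type*} [Fintype ι] {g : ι → S} {x : S}
    (hx : x ∈ vanishingIdeal (Submodule.span k (Set.range g)) ε) :
    ∃ v : ι → S, ∑ i, v i * g i = x ∧ ∑ i, v i * algebraMap k S (ε (g i)) = 0 := by
  let relations : Submodule S (S × S) := LinearMap.range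
    ((Fintype.linearCombination S g).prod
      (Fintype.linearCombination S fun i => algebraMap k S (ε (g i))))
  suffices vanishingIdeal (Submodule.span k (Set.range g)) ε ≤
      relations.comap (LinearMap.inl S S S) by
    obtain ⟨v, hv⟩ := this hx
    exact ⟨v, congrArg Prod.fst hv, congrArg Prod.snd hv⟩
  refine vanishingIdeal_le_iff.2 fun u hu hεu => ?_
  obtain ⟨a, rfl⟩ := (Submodule.mem_span_range_iff_exists_fun k).1 hu
  refine ⟨fun i => algebraMap k S (a i), Prod.ext ?_ ?_⟩
  · simp [Fintype.linearCombination_apply, Algebra.smul_def, Prod.fst_sum]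
  · simpa [Fintype.linearCombination_apply, Prod.snd_sum] using congrArg (algebraMap k S) hεu

end PointedSpaces

section RowIdealsAtPoints

variable {k : Type*} [Field k] {n m c : ℕ} {I : Ideal (MvPolynomial (Fin (n + 1)) k)}
  {g : Fin m → MvPolynomial (Fin (n + 1)) k}
  {A : Matrix (Fin m) (Fin c) (MvPolynomial (Fin (n + 1)) k)}

theorem generalizedRowIdeal_single (i : Fin m) :
    generalizedRowIdeal A (Pi.single i 1) = rowIdeal A i := by
  simp [generalizedRowIdeal, rowIdeal, Pi.single_apply]

namespace IsHomogeneousPresentation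

theorem sum_column_mul (h : IsHomogeneousPresentation I g A) (j : Fin c) :
    ∑ i, A i j * g i = 0 :=
  (h.exact fun i => A i j).2 (Submodule.subset_span ⟨j, rfl⟩)

theorem sum_mem_generalizedRowIdeal (h : IsHomogeneousPresentation I g A) (q : Fin m → k)
    {v : Fin m → MvPolynomial (Fin (n + 1)) k} (hv : ∑ i, v i * g i = 0) :
    ∑ i, v i * C (q i) ∈ generalizedRowIdeal A q := by
  have hle : Submodule.span (MvPolynomial (Fin (n + 1)) k) (Set.range fun j i => A i j) ≤
      Submodule.comap (Fintype.linearCombination _ fun i => C (q i))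
        (generalizedRowIdeal A q) := by
    rw [Submodule.span_le]
    rintro _ ⟨j, rfl⟩
    refine Ideal.subset_span ⟨j, ?_⟩
    simp [Fintype.linearCombination_apply, mul_comm]
  exact hle ((h.exact v).1 hv)

theorem generalizedRowIdeal_eq_colon (h : IsHomogeneousPresentation I g A)
    {ε : MvPolynomial (Fin (n + 1)) k →ₐ[k] k} {w : MvPolynomial (Fin (n + 1)) k}
    (hw : w ∈ Submodule.span k (Set.range g)) (hεw : ε w = 1) :
    generalizedRowIdeal A (fun i => ε (g i)) =
      (vanishingIdeal (Submodule.span k (Set.range g)) ε).colon {w} := by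
  refine le_antisymm (Ideal.span_le.2 ?_) fun f hf => ?_
  · rintro _ ⟨j, rfl⟩
    have hmul : (∑ i, C (ε (g i)) * A i j) * w = ∑ i, A i j * (ε (g i) • w - g i) := by
      simp only [mul_sub, Finset.sum_sub_distrib, h.sum_column_mul, sub_zero, Finset.sum_mul,
        smul_eq_C_mul]
      exact Finset.sum_congr rfl fun i _ => by ring
    rw [SetLike.mem_coe, Submodule.mem_colon_singleton, smul_eq_mul, hmul]
    refine Ideal.sum_mem _ fun i _ => Ideal.mul_mem_left _ _ (mem_vanishingIdeal ?_ ?_)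
    · exact sub_mem (Submodule.smul_mem _ _ hw) (Submodule.subset_span ⟨i, rfl⟩)
    · simp [hεw]
  · obtain ⟨v, hv, hεv⟩ :=
      exists_sum_mul_eq_of_mem_vanishingIdeal (Submodule.mem_colon_singleton.1 hf)
    obtain ⟨a, rfl⟩ := (Submodule.mem_span_range_iff_exists_fun k).1 hw
    have hsyz : ∑ i, (f * C (a i) - v i) * g i = 0 := by
      simp only [sub_mul, Finset.sum_sub_distrib, hv, mul_assoc, ← Finset.mul_sum, smul_eq_C_mul,
        smul_eq_mul, sub_self]
    have hsum : ∑ i, (f * C (a i) - v i) * C (ε (g i)) = f := by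
      rw [algebraMap_eq] at hεv
      simp only [sub_mul, Finset.sum_sub_distrib, hεv, mul_assoc, ← Finset.mul_sum, ← C_mul,
        ← map_sum]
      simp only [map_sum, map_smul, smul_eq_mul] at hεw
      simp [hεw]
    exact hsum ▸ h.sum_mem_generalizedRowIdeal _ hsyz

end IsHomogeneousPresentation

end RowIdealsAtPoints

section DualPoints

variable {k : Type*} [Field k]

theorem exists_basis_dual_mem_of_separating {V : Type*} [AddCommGroup V] [Module k V]
    [FiniteDimensional k V] {s : Set (Dual k V)} (hs : ∀ v ≠ 0, ∃ φ ∈ s, φ v ≠ 0) :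
    ∃ (N : ℕ) (b : Basis (Fin N) k V) (φ : Fin N → Dual k V),
      (∀ i, φ i ∈ s) ∧ ∀ i j, φ i (b j) = if j = i then 1 else 0 := by
  have hspan : ⊤ ≤ Submodule.span k s := (Submodule.span_eq_top_of_ne_zero hs).ge
  have : Finite ((linearIndepOn_empty k id).extend s.empty_subset) :=
    Module.Finite.finite_basis (Basis.ofSpan hspan)
  obtain ⟨N, ⟨e⟩⟩ := Finite.exists_equiv_fin ((linearIndepOn_empty k id).extend s.empty_subset)
  let φ : Basis (Fin N) k (Dual k V) := (Basis.ofSpan hspan).reindex e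
  refine ⟨N, φ.dualBasis.map (evalEquiv k V).symm, φ, fun i => ?_, fun i j => ?_⟩
  · exact Basis.ofSpan_subset hspan ⟨e.symm i, (Basis.reindex_apply _ _ _).symm⟩
  · simp [Module.apply_evalEquiv_symm_apply, Finsupp.single_apply, eq_comm]

theorem exists_basis_eval_eq_ite [Infinite k] {σ : Type*} (U : Submodule k (MvPolynomial σ k))
    [FiniteDimensional k U] {f : MvPolynomial σ k} (hf : f ≠ 0) :
    ∃ (N : ℕ) (b : Basis (Fin N) k U) (p : Fin N → σ → k), (∀ i, eval (p i) f ≠ 0) ∧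
      ∀ i j, eval (p i) (b j : MvPolynomial σ k) = if j = i then 1 else 0 := by
  let evalAt (x : σ → k) : Dual k U := (aeval x).toLinearMap ∘ₗ U.subtype
  have hseparating : ∀ u : U, u ≠ 0 → ∃ φ ∈ evalAt '' {x | eval x f ≠ 0}, φ u ≠ 0 := by
    intro u hu
    have huf : (u : MvPolynomial σ k) * f ≠ 0 := mul_ne_zero (by simpa using hu) hf
    obtain ⟨x, hx⟩ := not_forall.1 fun h => huf (MvPolynomial.funext (by simpa using h))
    obtain ⟨hux, hfx⟩ := not_or.1 hx
    exact ⟨_, ⟨x, hfx, rfl⟩, by simpa [evalAt, aeval_eq_eval] using hux⟩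
  obtain ⟨N, b, φ, hφ, hb⟩ := exists_basis_dual_mem_of_separating hseparating
  choose p hp hpφ using hφ
  exact ⟨N, b, p, hp, fun i j => by rw [← hb i j, ← hpφ]; simp [evalAt, aeval_eq_eval]⟩

theorem exists_presentation_dual_to_points [Infinite k] {n D : ℕ}
    {U : Submodule k (MvPolynomial (Fin (n + 1)) k)} [FiniteDimensional k U]
    (hU : U ≤ homogeneousSubmodule (Fin (n + 1)) k D)
    {f : MvPolynomial (Fin (n + 1)) k} (hf : f ≠ 0) :
    ∃ (N c : ℕ) (b : Fin N → MvPolynomial (Fin (n + 1)) k)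
      (B : Matrix (Fin N) (Fin c) (MvPolynomial (Fin (n + 1)) k)) (p : Fin N → Fin (n + 1) → k),
      IsHomogeneousPresentation (Ideal.span (U : Set (MvPolynomial (Fin (n + 1)) k))) b B ∧
        Submodule.span k (Set.range b) = U ∧ (∀ i, eval (p i) f ≠ 0) ∧
        ∀ i, (fun j => aeval (p i) (b j)) = (Pi.single i 1 : Fin N → k) := by
  obtain ⟨N, b, p, hp, hb⟩ := exists_basis_eval_eq_ite U hf
  let b' : Fin N → MvPolynomial (Fin (n + 1)) k := U.subtype ∘ b
  have hspan : Submodule.span k (Set.range b') = U := by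
    rw [Set.range_comp, Submodule.span_image, b.span_eq, Submodule.map_top, Submodule.range_subtype]
  have hmin : ∀ i, b' i ∉ Ideal.span (b' '' {j | j ≠ i}) := by
    intro i hi
    have hker : Ideal.span (b' '' {j | j ≠ i}) ≤ RingHom.ker (eval (p i)) := by
      rw [Ideal.span_le]
      rintro _ ⟨j, hj, rfl⟩
      exact (hb i j).trans (if_neg hj)
    exact one_ne_zero (((hb i i).trans (if_pos rfl)).symm.trans (hker hi))
  obtain ⟨c, B, hB⟩ := exists_isHomogeneousPresentation (fun i => hU (b i).2) hmin
  refine ⟨N, c, b', B, p, ?_, hspan, hp, fun i => ?_⟩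
  · rwa [← hspan, Ideal.span, Submodule.span_span_of_tower]
  · ext j
    rw [aeval_eq_eval, Pi.single_apply]
    exact hb i j

end DualPoints

section GenericRowIdeals

theorem exists_mem_eq_one_of_ne_zero {k S : Type*} [Field k] [CommRing S] [Algebra k S]
    {W : Submodule k S} {ε : S →ₐ[k] k} {u : S} (hu : u ∈ W) (hεu : ε u ≠ 0) :
    ∃ w ∈ W, ε w = 1 :=
  ⟨(ε u)⁻¹ • u, W.smul_mem _ hu, by rw [map_smul, smul_eq_mul, inv_mul_cancel₀ hεu]⟩

open Matrix

variable {k : Type*} [Field k] {n m c : ℕ} {I : Ideal (MvPolynomial (Fin (n + 1)) k)}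
  {g : Fin m → MvPolynomial (Fin (n + 1)) k}
  {A : Matrix (Fin m) (Fin c) (MvPolynomial (Fin (n + 1)) k)}

theorem IsLinearIdeal.isPrime {J : Ideal (MvPolynomial (Fin (n + 1)) k)} (hJ : IsLinearIdeal J) :
    J.IsPrime := by
  obtain ⟨T, hT, rfl⟩ := hJ
  rw [span_eq_linearIdeal hT]
  infer_instance

theorem IsLinearIdeal.constantCoeff_eq_zero {J : Ideal (MvPolynomial (Fin (n + 1)) k)}
    (hJ : IsLinearIdeal J) {f : MvPolynomial (Fin (n + 1)) k} (hf : f ∈ J) :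
    constantCoeff f = 0 := by
  obtain ⟨T, hT, rfl⟩ := hJ
  have hle : Ideal.span T ≤ RingHom.ker constantCoeff :=
    Ideal.span_le.2 fun f hf => (hT f hf).coeff_eq_zero (by simp)
  exact hle hf

theorem linearIdeal_span_row_le_ker {κ σ : Type*} [Fintype σ] {M : Matrix κ σ k} {y : σ → k}
    (hy : M *ᵥ y = 0) :
    linearIdeal (Submodule.span k (Set.range M.row)) ≤ RingHom.ker (eval y) := by
  rw [linearIdeal_span, Ideal.span_le, ← Set.range_comp]
  rintro _ ⟨j, rfl⟩
  simpa [linearForm_apply, Matrix.mulVec, dotProduct] using! congrFun hy j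

/-- The matrix whose value at a point `p` has as rows the coefficient vectors of the linear parts
of the generators of the generalized row ideal of `A` at `p`. -/
noncomputable def linearPartMatrix (g : Fin m → MvPolynomial (Fin (n + 1)) k)
    (A : Matrix (Fin m) (Fin c) (MvPolynomial (Fin (n + 1)) k)) :
    Matrix (Fin c) (Fin (n + 1)) (MvPolynomial (Fin (n + 1)) k) :=
  .of fun j l => ∑ i, linearCoeff (A i j) l • g i

theorem linearPartMatrix_mem_span (j : Fin c) (l : Fin (n + 1)) :
    linearPartMatrix g A j l ∈ Submodule.span k (Set.range g) := by
  rw [linearPartMatrix, Matrix.of_apply]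
  exact sum_mem fun i _ => Submodule.smul_mem _ _ (Submodule.subset_span (Set.mem_range_self i))

theorem map_linearPartMatrix_row (p : Fin (n + 1) → k) (j : Fin c) :
    ((linearPartMatrix g A).map (eval p)).row j =
      linearCoeff (∑ i, C (aeval p (g i)) * A i j) := by
  ext l
  simp [linearPartMatrix, smul_eq_C_mul, coeff_sum, coeff_C_mul, aeval_eq_eval,
    mul_comm (eval p _)]

theorem generalizedRowIdeal_eq_linearIdeal {p : Fin (n + 1) → k}
    (hlin : IsLinearIdeal (generalizedRowIdeal A fun i => aeval p (g i))) :
    generalizedRowIdeal A (fun i => aeval p (g i)) =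
      linearIdeal (Submodule.span k (Set.range ((linearPartMatrix g A).map (eval p)).row)) := by
  have hconst (j : Fin c) : constantCoeff (∑ i, C (aeval p (g i)) * A i j) = 0 :=
    hlin.constantCoeff_eq_zero (Ideal.subset_span (Set.mem_range_self j))
  have hrow := funext (map_linearPartMatrix_row (g := g) (A := A) p)
  obtain ⟨T, hT, hJ⟩ := hlin
  rw [hJ, span_eq_linearIdeal hT, ← hJ, generalizedRowIdeal,
    map_linearCoeff_span (Set.forall_mem_range.2 hconst), ← Set.range_comp, hrow]
  rfl

namespace IsHomogeneousPresentation

theorem linearPartMatrix_mulVec_X {δ : ℕ} (h : IsHomogeneousPresentation I g A)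
    (hg : ∀ i, (g i).IsHomogeneous δ) : linearPartMatrix g A *ᵥ X = 0 := by
  funext j
  have hcomponent := congrArg (homogeneousComponent (δ + 1)) (h.sum_column_mul j)
  rw [map_sum, map_zero] at hcomponent
  rw [Pi.zero_apply, ← hcomponent]
  simp only [linearPartMatrix, mulVec, dotProduct, of_apply, Finset.sum_mul]
  rw [Finset.sum_comm]
  refine Finset.sum_congr rfl fun i _ => ?_
  rw [homogeneousComponent_mul_add _ (hg i), ← linearForm_linearCoeff, linearForm_apply,
    Finset.sum_mul]
  exact Finset.sum_congr rfl fun l _ => by rw [smul_eq_C_mul, mul_right_comm]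

theorem ideal_span_span (h : IsHomogeneousPresentation I g A) :
    Ideal.span (Submodule.span k (Set.range g) : Set (MvPolynomial (Fin (n + 1)) k)) = I :=
  (Submodule.span_span_of_tower k _ _).trans h.span_eq

theorem isEmpty_of_bot (h : IsHomogeneousPresentation ⊥ g A) : IsEmpty (Fin m) where
  false i := by
    have hg : g i = 0 := Ideal.mem_bot.1 (h.span_eq ▸ Ideal.subset_span (Set.mem_range_self i))
    exact h.minimal i (hg ▸ zero_mem _)

theorem isLinearIdeal_generalizedRowIdeal
    (hlin : ∀ q : Fin m → k, q ≠ 0 → IsLinearIdeal (generalizedRowIdeal A q))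
    {ε : MvPolynomial (Fin (n + 1)) k →ₐ[k] k} {w : MvPolynomial (Fin (n + 1)) k}
    (hw : w ∈ Submodule.span k (Set.range g)) (hεw : ε w = 1) :
    IsLinearIdeal (generalizedRowIdeal A fun i => ε (g i)) := by
  refine hlin _ fun hzero => ?_
  have hle : Submodule.span k (Set.range g) ≤ LinearMap.ker ε.toLinearMap :=
    Submodule.span_le.2 (Set.range_subset_iff.2 (congrFun hzero))
  exact one_ne_zero (hεw.symm.trans (hle hw))

theorem eval_mul_eval_eq (h : IsHomogeneousPresentation I g A)
    (hlin : ∀ q : Fin m → k, q ≠ 0 → IsLinearIdeal (generalizedRowIdeal A q))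
    {p y : Fin (n + 1) → k} (hy : (linearPartMatrix g A).map (eval p) *ᵥ y = 0)
    {v w : MvPolynomial (Fin (n + 1)) k} (hv : v ∈ Submodule.span k (Set.range g))
    (hw : w ∈ Submodule.span k (Set.range g)) :
    eval y v * eval p w = eval y w * eval p v := by
  by_cases hp : ∃ u ∈ Submodule.span k (Set.range g), aeval p u ≠ (0 : k)
  · obtain ⟨u, hu, hpu⟩ := hp
    obtain ⟨w₀, hw₀, hpw₀⟩ := exists_mem_eq_one_of_ne_zero hu hpu
    have hvanish : eval p w • v - eval p v • w ∈
        vanishingIdeal (Submodule.span k (Set.range g)) (aeval p) :=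
      mem_vanishingIdeal (sub_mem (Submodule.smul_mem _ _ hv) (Submodule.smul_mem _ _ hw))
        (by simp [aeval_eq_eval, mul_comm])
    have hrow := Ideal.le_colon (S := {w₀}) hvanish
    rw [← h.generalizedRowIdeal_eq_colon hw₀ hpw₀, generalizedRowIdeal_eq_linearIdeal
      (isLinearIdeal_generalizedRowIdeal hlin hw₀ hpw₀)] at hrow
    have hzero := linearIdeal_span_row_le_ker hy hrow
    simp only [RingHom.mem_ker, map_sub, smul_eval] at hzero
    linear_combination hzero
  · push Not at hp
    simp only [aeval_eq_eval] at hp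
    rw [hp v hv, hp w hw, mul_zero, mul_zero]

theorem exists_generic_height [Infinite k] {δ : ℕ}
    (h : IsHomogeneousPresentation I g A) (hg : ∀ i, (g i).IsHomogeneous δ)
    (hlin : ∀ q : Fin m → k, q ≠ 0 → IsLinearIdeal (generalizedRowIdeal A q)) (hI : I ≠ ⊥) :
    ∃ f : MvPolynomial (Fin (n + 1)) k, f ≠ 0 ∧ ∀ p, eval p f ≠ 0 →
      (∃ w ∈ Submodule.span k (Set.range g), aeval p w = (1 : k)) ∧
      ((generalizedRowIdeal A fun i => aeval p (g i)).height : WithBot ℕ∞) + 1 =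
        analyticSpread I := by
  have hV : Submodule.span k (Set.range g) ≤ homogeneousSubmodule (Fin (n + 1)) k δ :=
    Submodule.span_le.2 (Set.range_subset_iff.2 hg)
  have hV0 : Submodule.span k (Set.range g) ≠ ⊥ := fun hV0 => hI <| by
    rw [← h.ideal_span_span, hV0]
    simp
  obtain ⟨r, ρ, γ, hminor⟩ := exists_isRankMinor (linearPartMatrix g A)
  have hspread : analyticSpread I = (r + 1 : ℕ) := by
    have := finiteType_coordinateRing (Submodule.fg_span (R := k) (Set.finite_range g))
    rw [← h.ideal_span_span, analyticSpread_span hV, ringKrullDim_eq_trdeg k,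
      trdeg_coordinateRing_eq_add_one hV hV0 linearPartMatrix_mem_span
        (h.linearPartMatrix_mulVec_X hg)
        (fun p y hy v hv w hw => h.eval_mul_eval_eq hlin hy hv hw) hminor]
    simp
  obtain ⟨u, hu, hu0⟩ := Submodule.exists_mem_ne_zero_of_ne_bot hV0
  refine ⟨_, mul_ne_zero hminor.det_ne_zero hu0, fun p hp => ?_⟩
  rw [map_mul, mul_ne_zero_iff] at hp
  obtain ⟨w, hw, hpw⟩ := exists_mem_eq_one_of_ne_zero (ε := aeval p) hu
    (by simpa [aeval_eq_eval] using hp.2)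
  refine ⟨⟨w, hw, hpw⟩, ?_⟩
  rw [generalizedRowIdeal_eq_linearIdeal (isLinearIdeal_generalizedRowIdeal hlin hw hpw),
    height_linearIdeal, ← rank_eq_finrank_span_row, hminor.rank_map _ hp.1, hspread]
  norm_cast

theorem rowIdeal_pow_eq {d N e : ℕ} {b : Fin N → MvPolynomial (Fin (n + 1)) k}
    {B : Matrix (Fin N) (Fin e) (MvPolynomial (Fin (n + 1)) k)}
    (h : IsHomogeneousPresentation I g A) (hB : IsHomogeneousPresentation (I ^ d) b B)
    (hb : Submodule.span k (Set.range b) = Submodule.span k (Set.range g) ^ d) (hd : d ≠ 0)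
    {ε : MvPolynomial (Fin (n + 1)) k →ₐ[k] k} {w : MvPolynomial (Fin (n + 1)) k}
    (hw : w ∈ Submodule.span k (Set.range g)) (hεw : ε w = 1)
    (hprime : (generalizedRowIdeal A fun i => ε (g i)).IsPrime) {i : Fin N}
    (hdual : (fun j => ε (b j)) = Pi.single i 1) :
    rowIdeal B i = generalizedRowIdeal A fun i => ε (g i) := by
  have hbi : b i ∈ Submodule.span k (Set.range b) := Submodule.subset_span ⟨i, rfl⟩
  have hεbi : ε (b i) = 1 := by simpa using congrFun hdual i
  rw [h.generalizedRowIdeal_eq_colon hw hεw] at hprime ⊢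
  rw [← generalizedRowIdeal_single, ← hdual, hB.generalizedRowIdeal_eq_colon hbi hεbi, hb]
  exact colon_vanishingIdeal_pow hw hεw hprime hd (hb ▸ hbi) hεbi

end IsHomogeneousPresentation

end GenericRowIdeals

end RowIdeals

open RowIdeals in
theorem mainTheorem6_general {k : Type*} [Field k] [Infinite k] (n δ : ℕ)
    (W : Submodule k (MvPolynomial (Fin (n + 1)) k))
    (hW : W ≤ MvPolynomial.homogeneousSubmodule (Fin (n + 1)) k δ)
    (I : Ideal (MvPolynomial (Fin (n + 1)) k))
    (hI : I = Ideal.span (W : Set (MvPolynomial (Fin (n + 1)) k)))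
    (hlin : HasLinearGeneralizedRowIdeals I) (d : ℕ) (hd : 1 ≤ d) :
    ∃ (m c : ℕ) (g : Fin m → MvPolynomial (Fin (n + 1)) k)
      (A : Matrix (Fin m) (Fin c) (MvPolynomial (Fin (n + 1)) k)),
      IsHomogeneousPresentation (I ^ d) g A ∧
        ∀ i : Fin m, IsLinearIdeal (rowIdeal A i) ∧
          ((rowIdeal A i).height : WithBot ℕ∞) + 1 = analyticSpread I := by
  obtain ⟨m, c, g, A, hA, hlin⟩ := hlin
  have hg : ∀ i, (g i).IsHomogeneous δ := hA.isHomogeneous (fun w hw => hW hw) hI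
  have hd0 : d ≠ 0 := Nat.one_le_iff_ne_zero.1 hd
  obtain rfl | hI0 := eq_or_ne I ⊥
  · exact ⟨m, c, g, A, by rwa [Ideal.bot_pow hd0], hA.isEmpty_of_bot.elim⟩
  obtain ⟨f, hf, hgeneric⟩ := hA.exists_generic_height hg hlin hI0
  have hV : Submodule.span k (Set.range g) ≤ MvPolynomial.homogeneousSubmodule _ k δ :=
    Submodule.span_le.2 (Set.range_subset_iff.2 hg)
  have : FiniteDimensional k ↥(Submodule.span k (Set.range g) ^ d) := Module.Finite.iff_fg.2
    ((Submodule.fg_span (Set.finite_range g)).pow d)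
  obtain ⟨N, e, b, B, p, hB, hb, hp, hdual⟩ :=
    exists_presentation_dual_to_points (pow_le_homogeneousSubmodule hV d) hf
  rw [← idealSpan_pow, hA.ideal_span_span] at hB
  refine ⟨N, e, b, B, hB, fun i => ?_⟩
  obtain ⟨⟨w, hw, hpw⟩, hheight⟩ := hgeneric (p i) (hp i)
  have hlinear := IsHomogeneousPresentation.isLinearIdeal_generalizedRowIdeal hlin hw hpw
  rw [hA.rowIdeal_pow_eq hB hb hd0 hw hpw hlinear.isPrime (hdual i)]
  exact ⟨hlinear, hheight⟩

theorem mainTheorem6 {k : Type*} [Field k] [Infinite k] (n δ : ℕ)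
    (W : Submodule k (MvPolynomial (Fin (n + 1)) k))
    (hW : W ≤ MvPolynomial.homogeneousSubmodule (Fin (n + 1)) k δ)
    (I : Ideal (MvPolynomial (Fin (n + 1)) k))
    (hI : I = Ideal.span (W : Set (MvPolynomial (Fin (n + 1)) k)))
    (hcodim : 2 ≤ I.height)
    (hlin : RowIdeals.IsLinearlyPresented I ∨ RowIdeals.HasLinearGeneralizedRowIdeals I)
    (d : ℕ) (hd : 1 ≤ d) :
    ∃ (m c : ℕ) (g : Fin m → MvPolynomial (Fin (n + 1)) k)
      (A : Matrix (Fin m) (Fin c) (MvPolynomial (Fin (n + 1)) k)),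
      RowIdeals.IsHomogeneousPresentation (I ^ d) g A ∧
        ∀ i : Fin m, RowIdeals.IsLinearIdeal (RowIdeals.rowIdeal A i) ∧
          ((RowIdeals.rowIdeal A i).height : WithBot ℕ∞) + 1 = RowIdeals.analyticSpread I :=
  mainTheorem6_general n δ W hW I hI
    (hlin.elim RowIdeals.IsLinearlyPresented.hasLinearGeneralizedRowIdeals id) d hd
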